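/- Notation. Let $C[-\infty,+\infty]$ be the continuous complex functions on the two-point compactification of $\mathbb R$. For a bounded continuous $f$ on $\mathbb R$ let $f(M)$ be multiplication by $f$ on $L^2(\mathbb R)$, let $F$ be the unitary Fourier transform $(Fu)(\xi)=(2\pi)^{-1/2}\int e^{-ix\xi}u(x)\,dx$ on $L^2(\mathbb R)$, and put $b(D)=F^{-1}b(M)F$. Let $\mathfrak A^\diamond$ be the C$^*$-algebra of bounded operators on $L^2(\mathbb R)$ generated by the multiplications by $2\pi$-periodic continuous functions and the operators $b(D)$, $b\in C[-\infty,+\infty]$, and let $\mathfrak A\supseteq\mathfrak A^\diamond$ be the one generated by these operators together with all $a(M)$, $a\in C[-\infty,+\infty]$. For $\varphi\in\mathbb R$ let $Y_\varphi$ be the unitary operator on $\ell^2(\mathbb Z)$ obtained by conjugating the operator $f(z)\mapsto z^{-\varphi}f(z)$ on $L^2(\mathbb S^1)$ (principal branch) with the discrete Fourier transform $f\mapsto(\int_{\mathbb S^1}f(z)z^{-k}\,dz)_{k\in\mathbb Z}$ ($dz$ the normalized Haar measure), so that $Y_j(u_k)_k=(u_{j+k})_k$ for $j\in\mathbb Z$;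 and for $b\in C[-\infty,+\infty]$ let $M^b_\varphi(a_j)_j=(b(j-\varphi)a_j)_j$. Write $\mathfrak B=\mathcal L(\ell^2(\mathbb Z))$ and $S^*\mathbb S^1=\mathbb S^1\times\{-1,+1\}$. Let $W:L^2(\mathbb R)\to L^2(\mathbb S^1;\ell^2(\mathbb Z))$ be the unitary operator $(Wu)(e^{2\pi i\varphi})=Y_\varphi\big((u(\varphi-j))_{j\in\mathbb Z}\big)$. For $g\in C(\mathbb S^1,\mathfrak B)$ let $\mu(g)$ be multiplication by $g$ on $L^2(\mathbb S^1;\ell^2(\mathbb Z))$. For $g\in C(S^*\mathbb S^1,\mathfrak B)$ put $g_\pm=g(\cdot,\pm1)$ and $$\iota(g)=\big(FW^{-1}\mu(g_-)WF^{-1},\;FW^{-1}\mu(g_+)WF^{-1}\big).$$ Theorem. There is exactly one (unital) $*$-homomorphism $\gamma:\mathfrak A\to C(S^*\mathbb S^1,\mathfrak B)$ such that, at every point $(e^{2\pi i\varphi},\pm1)$ with $\varphi\in\mathbb R$: $\gamma(a(M))=a(\pm\infty)I$ for $a\in C[-\infty,+\infty]$; $\gamma(e_k(M))=Y_{-k}$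 for $e_k(x)=e^{ikx}$, $k\in\mathbb Z$; and $\gamma(b(D))=Y_\varphi M^b_\varphi Y_{-\varphi}$ for $b\in C[-\infty,+\infty]$. Moreover, there is a surjective $*$-homomorphism $$\psi:\mathfrak A\longrightarrow\mathfrak A^\diamond\oplus\mathfrak A^\diamond$$ such that $\psi(A)=(A,A)$ for $A\in\mathfrak A^\diamond$; $\psi(a(M))=(a(-\infty)I,a(+\infty)I)$ for $a\in C[-\infty,+\infty]$; every compact operator $K$ on $L^2(\mathbb R)$ belongs to $\mathfrak A$, and $\psi(K)=0$; and $\iota\circ\gamma=\psi$. The restriction of $\iota$ to the image of $\gamma$ is a $*$-isomorphism $\operatorname{Im}\gamma\cong\mathfrak A^\diamond\oplus\mathfrak A^\diamond$. -/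

import Mathlib

open MeasureTheory AddCircle BoundedContinuousFunction
open scoped ENNReal

noncomputable section
namespace PeriodicPsiDO

/-- The Hilbert space `L²(ℝ)`. -/
abbrev L2R : Type := Lp ℂ 2 (volume : Measure ℝ)
/-- The Hilbert space `ℓ²(ℤ)`. -/
abbrev ell2 : Type := lp (fun _ : ℤ => ℂ) 2
/-- The unit circle, written additively as `ℝ/ℤ`: the class of `φ` stands for `e^{2πiφ}`. -/
abbrev S1 : Type := UnitAddCircle
/-- `L²(S¹; ℓ²(ℤ))`, with respect to the Haar probability measure. -/
abbrev L2S : Type := Lp ell2 2 (haarAddCircle : Measure S1)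
/-- The co-sphere bundle `S*S¹ = S¹ × {-1, +1}`. -/
abbrev CoSphere : Type := S1 × ℤˣ

/-- Multiplication by the essentially bounded function `f` on `L²`. -/
def mulOp {α : Type*} [MeasurableSpace α] {μ : Measure α} (f : α → ℂ) (hf : MemLp f ∞ μ) :
    Lp ℂ 2 μ →L[ℂ] Lp ℂ 2 μ :=
  (ContinuousLinearMap.mul ℂ ℂ).holderL μ ∞ 2 2 (hf.toLp f)

theorem mulOp_coe {α : Type*} [MeasurableSpace α] {μ : Measure α} (f : α → ℂ) (hf : MemLp f ∞ μ)
    (u : Lp ℂ 2 μ) : mulOp f hf u =ᵐ[μ] fun x => f x * u x := by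
  have h := ContinuousLinearMap.coeFn_holder (r := 2) (ContinuousLinearMap.mul ℂ ℂ) (hf.toLp f) u
  filter_upwards [h, hf.coeFn_toLp] with x hx h2
  rw [mulOp, ContinuousLinearMap.holderL_apply_apply, hx, h2]; rfl

theorem pullIso_memLp {X Y E G : Type*} [MeasurableSpace X] [MeasurableSpace Y] {μ : Measure X}
    {ν : Measure Y} [NormedAddCommGroup E] [NormedSpace ℂ E] [NormedAddCommGroup G]
    [NormedSpace ℂ G] {π : X → Y} (hπ : Measure.QuasiMeasurePreserving π μ ν)
    {L : X → E →L[ℂ] G} (hL : AEStronglyMeasurable L μ)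
    (h : ∀ f : Y → E, AEStronglyMeasurable f ν →
      eLpNorm (fun x => L x (f (π x))) 2 μ = eLpNorm f 2 ν)
    (f : Lp E 2 ν) : MemLp (fun x => L x (f (π x))) 2 μ :=
  ⟨(ContinuousLinearMap.id ℂ (E →L[ℂ] G)).aestronglyMeasurable_comp₂ hL
    ((Lp.aestronglyMeasurable f).comp_quasiMeasurePreserving hπ),
    (h f (Lp.aestronglyMeasurable f)).trans_lt (Lp.eLpNorm_lt_top f)⟩

/-- The isometry `f ↦ (x ↦ L x (f (π x)))` between `L²` spaces. -/
def pullIso {X Y E G : Type*} [MeasurableSpace X] [MeasurableSpace Y] {μ : Measure X}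
    {ν : Measure Y} [NormedAddCommGroup E] [NormedSpace ℂ E] [NormedAddCommGroup G]
    [NormedSpace ℂ G] {π : X → Y} (hπ : Measure.QuasiMeasurePreserving π μ ν)
    {L : X → E →L[ℂ] G} (hL : AEStronglyMeasurable L μ)
    (h : ∀ f : Y → E, AEStronglyMeasurable f ν →
      eLpNorm (fun x => L x (f (π x))) 2 μ = eLpNorm f 2 ν) :
    Lp E 2 ν →ₗᵢ[ℂ] Lp G 2 μ where
  toFun f := (pullIso_memLp hπ hL h f).toLp _
  map_add' f g := by
    rw [← MemLp.toLp_add (pullIso_memLp hπ hL h f) (pullIso_memLp hπ hL h g)]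
    refine MemLp.toLp_congr _ _ ?_
    filter_upwards [hπ.ae_eq_comp (Lp.coeFn_add f g)] with x hx
    simp only [Function.comp_apply, Pi.add_apply] at hx
    rw [Pi.add_apply, ← map_add, ← hx]
  map_smul' c f := by
    rw [RingHom.id_apply, ← MemLp.toLp_const_smul c (pullIso_memLp hπ hL h f)]
    refine MemLp.toLp_congr _ _ ?_
    filter_upwards [hπ.ae_eq_comp (Lp.coeFn_smul c f)] with x hx
    simp only [Function.comp_apply, Pi.smul_apply] at hx
    rw [Pi.smul_apply, ← map_smul, ← hx]
  norm_map' f := by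
    simp only [LinearMap.coe_mk, AddHom.coe_mk]
    rw [Lp.norm_toLp, h f (Lp.aestronglyMeasurable f), Lp.norm_def]

theorem pullIso_coe {X Y E G : Type*} [MeasurableSpace X] [MeasurableSpace Y] {μ : Measure X}
    {ν : Measure Y} [NormedAddCommGroup E] [NormedSpace ℂ E] [NormedAddCommGroup G]
    [NormedSpace ℂ G] {π : X → Y} (hπ : Measure.QuasiMeasurePreserving π μ ν)
    {L : X → E →L[ℂ] G} (hL : AEStronglyMeasurable L μ)
    (h : ∀ f : Y → E, AEStronglyMeasurable f ν →
      eLpNorm (fun x => L x (f (π x))) 2 μ = eLpNorm f 2 ν) (f : Lp E 2 ν) :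
    pullIso hπ hL h f =ᵐ[μ] fun x => L x (f (π x)) :=
  MemLp.coeFn_toLp (pullIso_memLp hπ hL h f)

theorem eLpNorm_two_congr {X Y E G : Type*} [MeasurableSpace X] [MeasurableSpace Y]
    {μ : Measure X} {ν : Measure Y} [NormedAddCommGroup E] [NormedAddCommGroup G]
    {f : X → E} {g : Y → G} (h : ∫⁻ x, ‖f x‖ₑ ^ 2 ∂μ = ∫⁻ y, ‖g y‖ₑ ^ 2 ∂ν) :
    eLpNorm f 2 μ = eLpNorm g 2 ν := by
  rw [eLpNorm_eq_lintegral_rpow_enorm_toReal (by simp) (by simp),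
    eLpNorm_eq_lintegral_rpow_enorm_toReal (by simp) (by simp)]
  simp only [ENNReal.toReal_ofNat, ENNReal.rpow_ofNat]
  rw [h]

theorem lintegral_dilation {c : ℝ} (hc : 0 < c) (f : ℝ → ℂ) :
    ∫⁻ x, ‖(Real.sqrt c : ℂ) * f (c * x)‖ₑ ^ 2 = ∫⁻ x, ‖f x‖ₑ ^ 2 := by
  have h1 : ∀ x, ‖(Real.sqrt c : ℂ) * f (c * x)‖ₑ ^ 2 = ENNReal.ofReal c * ‖f (c * x)‖ₑ ^ 2 := by
    intro x
    rw [enorm_mul, mul_pow]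
    congr 1
    rw [← ofReal_norm, Complex.norm_real, Real.norm_of_nonneg (Real.sqrt_nonneg c),
      ← ENNReal.ofReal_pow (Real.sqrt_nonneg c), Real.sq_sqrt hc.le]
  simp_rw [h1]
  rw [lintegral_const_mul' _ _ ENNReal.ofReal_ne_top]
  have h2 := (Homeomorph.mulLeft₀ c hc.ne').measurableEmbedding.lintegral_map
    (μ := volume) (fun y => ‖f y‖ₑ ^ 2)
  have h3 : (⇑(Homeomorph.mulLeft₀ c hc.ne')) = (c * ·) := rfl
  rw [h3, Real.map_volume_mul_left hc.ne', lintegral_smul_measure] at h2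
  rw [← h2, smul_eq_mul, ← mul_assoc, ← ENNReal.ofReal_mul hc.le, abs_of_pos (inv_pos.2 hc),
    mul_inv_cancel₀ hc.ne', ENNReal.ofReal_one, one_mul]

theorem quasi_mul {c : ℝ} (hc : 0 < c) :
    Measure.QuasiMeasurePreserving (fun x : ℝ => c * x) volume volume :=
  ⟨measurable_const_mul c, by
    rw [Real.map_volume_mul_left hc.ne']; exact Measure.smul_absolutelyContinuous⟩

/-- The isometry `f ↦ √c · f(c ·)` of `L²(ℝ)`. -/
def dilationIso (c : ℝ) (hc : 0 < c) : L2R →ₗᵢ[ℂ] L2R :=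
  pullIso (π := fun x => c * x) (quasi_mul hc)
    (L := fun _ => ContinuousLinearMap.mul ℂ ℂ (Real.sqrt c : ℂ)) aestronglyMeasurable_const
    (fun f _ => eLpNorm_two_congr (lintegral_dilation hc f))

theorem dilationIso_coe (c : ℝ) (hc : 0 < c) (f : L2R) :
    dilationIso c hc f =ᵐ[volume] fun x => (Real.sqrt c : ℂ) * f (c * x) :=
  pullIso_coe _ _ _ _

theorem dilationIso_inv (c : ℝ) (hc : 0 < c) (f : L2R) :
    dilationIso c hc (dilationIso c⁻¹ (inv_pos.2 hc) f) = f := by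
  apply Lp.ext
  filter_upwards [dilationIso_coe c hc (dilationIso c⁻¹ (inv_pos.2 hc) f),
    (quasi_mul hc).ae_eq_comp (dilationIso_coe c⁻¹ (inv_pos.2 hc) f)] with x h1 h2
  simp only [Function.comp_apply] at h2
  rw [h1, h2, ← mul_assoc, ← mul_assoc, inv_mul_cancel₀ hc.ne', one_mul, ← Complex.ofReal_mul,
    ← Real.sqrt_mul hc.le, mul_inv_cancel₀ hc.ne', Real.sqrt_one, Complex.ofReal_one, one_mul]

/-- The unitary `f ↦ √c · f(c ·)` of `L²(ℝ)`. -/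
def dilation (c : ℝ) (hc : 0 < c) : L2R ≃ₗᵢ[ℂ] L2R :=
  LinearIsometryEquiv.ofSurjective (dilationIso c hc) fun f => ⟨_, dilationIso_inv c hc f⟩

theorem two_pi_inv_pos : 0 < (2 * Real.pi)⁻¹ := inv_pos.2 Real.two_pi_pos

/-- The unitary Fourier transform `F` on `L²(ℝ)` in the angular-frequency normalization,
`(F u)(ξ) = (2π)^{-1/2} ∫ e^{-ixξ} u(x) dx`, that is `(F u)(ξ) = (2π)^{-1/2} (𝓕 u)(ξ / 2π)` in terms
of Mathlib's transform `𝓕`. -/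
def fourierL2 : L2R ≃ₗᵢ[ℂ] L2R :=
  (Lp.fourierTransformₗᵢ ℝ ℂ).trans (dilation (2 * Real.pi)⁻¹ two_pi_inv_pos)

theorem fourierL2_coe (u : L2R) :
  fourierL2 u =ᵐ[volume] fun ξ => (Real.sqrt (2 * Real.pi)⁻¹ : ℂ) *
      (Lp.fourierTransformₗᵢ ℝ ℂ u : L2R) ((2 * Real.pi)⁻¹ * ξ) :=
  dilationIso_coe _ two_pi_inv_pos _

/-- The defining formula of `fourierL2` on Schwartz functions. -/
theorem fourierL2_schwartz (u : SchwartzMap ℝ ℂ) :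
    fourierL2 (u.toLp 2) =ᵐ[volume] fun ξ => ((Real.sqrt (2 * Real.pi)⁻¹ : ℝ) : ℂ) *
      ∫ x : ℝ, Complex.exp (-(Complex.I * x * ξ)) * u x := by
  have h := (quasi_mul two_pi_inv_pos).ae_eq_comp
    (SchwartzMap.coeFn_toLp (FourierTransform.fourier u) 2 volume)
  filter_upwards [fourierL2_coe (u.toLp 2), h] with ξ h1 h2
  have h3 : (Lp.fourierTransformₗᵢ ℝ ℂ (u.toLp 2) : L2R) =
    (FourierTransform.fourier u).toLp 2 volume := SchwartzMap.toLp_fourier_eq u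
  simp only [Function.comp_apply] at h2
  rw [h1, h3, h2, SchwartzMap.fourier_coe, Real.fourier_real_eq_integral_exp_smul]
  congr 1
  refine integral_congr_ae (Filter.Eventually.of_forall fun x => ?_)
  beta_reduce
  rw [smul_eq_mul]
  congr 2
  have := Real.pi_ne_zero
  push_cast
  field_simp

/-- The function `z ↦ z^{-φ}` on the circle (principal branch), with `z = toCircle x = e^{2πix}`. -/
def circlePow (φ : ℝ) (x : S1) : ℂ := (toCircle x : ℂ) ^ (-(φ : ℂ))

theorem circlePow_eq (φ : ℝ) (x : S1) :
    circlePow φ x = Complex.exp (((-(Complex.arg (toCircle x) * φ) : ℝ) : ℂ) * Complex.I) := by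
  have h : Complex.log (toCircle x : ℂ) = (Complex.arg (toCircle x) : ℂ) * Complex.I := by
    have hn : ‖(toCircle x : ℂ)‖ = 1 := Circle.norm_coe _
    apply Complex.ext <;> simp [Complex.log_re, Complex.log_im, hn]
  rw [circlePow, Complex.cpow_def_of_ne_zero (Circle.coe_ne_zero _), h]
  push_cast
  ring_nf

theorem norm_circlePow (φ : ℝ) (x : S1) : ‖circlePow φ x‖ = 1 := by
  rw [circlePow_eq, Complex.norm_exp_ofReal_mul_I]

theorem circlePow_add (φ χ : ℝ) (x : S1) : circlePow (φ + χ) x = circlePow φ x * circlePow χ x := by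
  rw [circlePow_eq, circlePow_eq, circlePow_eq, ← Complex.exp_add]
  push_cast
  ring_nf

theorem circlePow_int (j : ℤ) (x : S1) : circlePow j x = fourier (-j) x := by
  rw [circlePow, fourier_apply, toCircle_zsmul, ← Complex.ofReal_neg]
  push_cast
  rw [← Complex.cpow_intCast]
  push_cast
  rfl

theorem norm_circlePow_sub_le (φ χ : ℝ) (x : S1) :
    ‖circlePow φ x - circlePow χ x‖ ≤ Real.pi * |φ - χ| := by
  have h1 : circlePow φ x - circlePow χ x = circlePow χ x * (circlePow (φ - χ) x - 1) := by
    rw [mul_sub, ← circlePow_add, mul_one, add_sub_cancel]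
  rw [h1, norm_mul, norm_circlePow, one_mul, circlePow_eq, mul_comm]
  refine (Real.norm_exp_I_mul_ofReal_sub_one_le).trans ?_
  rw [Real.norm_eq_abs, abs_neg, abs_mul]
  exact mul_le_mul_of_nonneg_right (Complex.abs_arg_le_pi _) (abs_nonneg _)

theorem measurable_circlePow (φ : ℝ) : Measurable (circlePow φ) := by
  have h : Measurable fun x : S1 => (toCircle x : ℂ) :=
    (continuous_subtype_val.comp continuous_toCircle).measurable
  exact h.pow_const _

theorem memLp_circlePow (φ : ℝ) : MemLp (circlePow φ) ∞ (haarAddCircle : Measure S1) :=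
  memLp_top_of_bound (measurable_circlePow φ).aestronglyMeasurable 1
    (Filter.Eventually.of_forall fun x => (norm_circlePow φ x).le)

/-- The operator `U_φ f(z) = z^{-φ} f(z)` on `L²(S¹)`. -/
def U (φ : ℝ) : Lp ℂ 2 (haarAddCircle : Measure S1) →L[ℂ] Lp ℂ 2 (haarAddCircle : Measure S1) :=
  mulOp (circlePow φ) (memLp_circlePow φ)

/-- The operator `Y_φ` on `ℓ²(ℤ)`: the conjugate of `U_φ` by the discrete Fourier transform
`L²(S¹) → ℓ²(ℤ)`, `f ↦ (∫ f(z) z^{-k} dz)_k`. -/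
def Y (φ : ℝ) : ell2 →L[ℂ] ell2 :=
  (fourierBasis.repr : Lp ℂ 2 (haarAddCircle : Measure S1) ≃ₗᵢ[ℂ] ell2) ∘L U φ ∘L
    (fourierBasis.repr.symm : ell2 ≃ₗᵢ[ℂ] Lp ℂ 2 (haarAddCircle : Measure S1))

theorem U_add (φ χ : ℝ) (u) : U (φ + χ) u = U φ (U χ u) := by
  apply Lp.ext
  filter_upwards [mulOp_coe _ (memLp_circlePow (φ + χ)) u, mulOp_coe _ (memLp_circlePow φ) (U χ u),
    mulOp_coe _ (memLp_circlePow χ) u] with x h1 h2 h3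
  rw [U, h1, U, h2, U, h3, circlePow_add, mul_assoc]

theorem norm_U (φ : ℝ) (u) : ‖U φ u‖ = ‖u‖ := by
  rw [Lp.norm_def, Lp.norm_def]
  congr 1
  apply eLpNorm_congr_norm_ae
  filter_upwards [mulOp_coe _ (memLp_circlePow φ) u] with x h
  rw [U, h, norm_mul, norm_circlePow, one_mul]

theorem continuous_U : Continuous U := by
  apply Metric.continuous_iff.2
  have key : ∀ φ χ : ℝ, dist (U φ) (U χ) ≤ Real.pi * dist φ χ := by
    intro φ χ
    rw [dist_eq_norm]
    refine ContinuousLinearMap.opNorm_le_bound _ (by positivity) fun u => ?_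
    refine Lp.norm_le_mul_norm_of_ae_le_mul ?_
    rw [_root_.sub_apply]
    filter_upwards [Lp.coeFn_sub (U φ u) (U χ u), mulOp_coe _ (memLp_circlePow φ) u,
      mulOp_coe _ (memLp_circlePow χ) u] with x h h1 h2
    rw [h, Pi.sub_apply, U, h1, U, h2, ← sub_mul, norm_mul]
    exact mul_le_mul_of_nonneg_right (norm_circlePow_sub_le φ χ x) (norm_nonneg _)
  intro χ ε hε
  refine ⟨ε / Real.pi, by positivity, fun φ h => (key φ χ).trans_lt ?_⟩
  rw [lt_div_iff₀ Real.pi_pos] at h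
  linarith

theorem Y_apply (φ : ℝ) (v : ell2) :
    Y φ v = fourierBasis.repr (U φ (fourierBasis.repr.symm v)) := rfl

theorem Y_add (φ χ : ℝ) (v : ell2) : Y (φ + χ) v = Y φ (Y χ v) := by
  simp only [Y_apply, U_add, LinearIsometryEquiv.symm_apply_apply]

theorem norm_Y (φ : ℝ) (v : ell2) : ‖Y φ v‖ = ‖v‖ := by
  simp only [Y_apply, LinearIsometryEquiv.norm_map, norm_U]

theorem continuous_Y : Continuous Y := by
  unfold Y
  exact continuous_const.clm_comp (continuous_U.clm_comp continuous_const)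

/-- For integers `j`, `Y j` is the shift `(v_k) ↦ (v_{j+k})`. -/
theorem Y_int (j : ℤ) (v : ell2) (k : ℤ) : Y j v k = v (j + k) := by
  obtain ⟨u, rfl⟩ := (fourierBasis.repr : Lp ℂ 2 (haarAddCircle : Measure S1) ≃ₗᵢ[ℂ] ell2).surjective v
  rw [Y_apply, LinearIsometryEquiv.symm_apply_apply, fourierBasis_repr, fourierBasis_repr]
  rw [fourierCoeff, fourierCoeff]
  apply integral_congr_ae
  filter_upwards [mulOp_coe _ (memLp_circlePow j) u] with x h
  rw [U, h, circlePow_int, smul_eq_mul, smul_eq_mul, ← mul_assoc, ← fourier_add]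
  congr 3
  ring

theorem Y_zero (v : ell2) : Y 0 v = v := by
  ext k
  have := Y_int 0 v k
  rw [Int.cast_zero, zero_add] at this
  exact this

theorem volume_eq_haar : (volume : Measure S1) = haarAddCircle := by
  rw [volume_eq_smul_haarAddCircle, ENNReal.ofReal_one, one_smul]

theorem lintegral_circle (f : S1 → ℝ≥0∞) :
    ∫⁻ x, f x ∂haarAddCircle = ∫⁻ y in Set.Ioc (0 : ℝ) 1, f y := by
  rw [← volume_eq_haar, ← UnitAddCircle.lintegral_preimage 0, zero_add]

theorem measurePreserving_Ioc (n : ℤ) : MeasurePreserving ((↑) : ℝ → S1)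
    (volume.restrict (Set.Ioc (n : ℝ) (n + 1))) haarAddCircle := by
  rw [← volume_eq_haar]
  exact UnitAddCircle.measurePreserving_mk n

theorem iUnion_Ioc_univ : ⋃ n : ℤ, Set.Ioc (n : ℝ) (n + 1) = Set.univ := by
  have := iUnion_Ioc_add_intCast (0 : ℝ)
  simpa using this

theorem quasi_coe : Measure.QuasiMeasurePreserving ((↑) : ℝ → S1) volume haarAddCircle := by
  refine ⟨AddCircle.measurable_mk', Measure.AbsolutelyContinuous.mk fun s hs h0 => ?_⟩
  rw [Measure.map_apply AddCircle.measurable_mk' hs, ← Measure.restrict_univ (μ := volume),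
    ← iUnion_Ioc_univ, Measure.restrict_iUnion_apply_ae]
  · refine ENNReal.tsum_eq_zero.2 fun n => ?_
    rw [(measurePreserving_Ioc n).measure_preimage hs.nullMeasurableSet, h0]
  · intro i j hij
    apply Disjoint.aedisjoint
    have := Set.pairwise_disjoint_Ioc_add_intCast (0 : ℝ) hij
    simpa [Function.onFun] using this
  · exact fun n => measurableSet_Ioc.nullMeasurableSet
  · exact AddCircle.measurable_mk' hs

theorem lintegral_periodize (g : ℝ → ℝ≥0∞) (hg : AEMeasurable g) :
    ∫⁻ x, g x = ∫⁻ x in Set.Ioc (0 : ℝ) 1, ∑' n : ℤ, g (x + n) := by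
  rw [lintegral_tsum]
  · conv_lhs => rw [← Measure.restrict_univ (μ := volume), ← iUnion_Ioc_univ]
    rw [lintegral_iUnion (fun n => measurableSet_Ioc)]
    · congr 1 with n
      have h := (measurePreserving_add_right (volume : Measure ℝ) (n : ℝ)).setLIntegral_comp_preimage_emb
        (MeasurableEquiv.addRight (n : ℝ)).measurableEmbedding g (Set.Ioc (n : ℝ) (n + 1))
      rw [← h]
      congr 2
      ext x
      simp
    · intro i j hij
      have := Set.pairwise_disjoint_Ioc_add_intCast (0 : ℝ) hij
      simpa [Function.onFun] using this
  · intro n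
    exact (hg.comp_quasiMeasurePreserving
      (measurePreserving_add_right (volume : Measure ℝ) (n : ℝ)).quasiMeasurePreserving).restrict

theorem tsum_enorm_sq (v : ell2) : ∑' k, ‖v k‖ₑ ^ 2 = ‖v‖ₑ ^ 2 := by
  have h := lp.hasSum_norm (p := 2) (by norm_num) v
  simp only [ENNReal.toReal_ofNat, Real.rpow_ofNat] at h
  have h2 := (ENNReal.ofReal_tsum_of_nonneg (fun n => by positivity) h.summable).symm
  rw [h.tsum_eq, ENNReal.ofReal_pow (norm_nonneg _), ofReal_norm] at h2
  rw [← h2]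
  congr 1 with k
  rw [ENNReal.ofReal_pow (norm_nonneg _), ofReal_norm]

/-- The coordinate functional `v ↦ v_j` on `ℓ²(ℤ)`. -/
def coord (j : ℤ) : ell2 →L[ℂ] ℂ :=
  LinearMap.mkContinuous
    { toFun := fun v => v j, map_add' := fun _ _ => rfl, map_smul' := fun _ _ => rfl } 1
    fun v => by rw [one_mul]; exact lp.norm_apply_le_norm (by norm_num) v j

theorem coord_apply (j : ℤ) (v : ell2) : coord j v = v j := rfl

theorem continuous_coord_Y : Continuous fun x : ℝ => coord 0 ∘L Y (-x) :=
  continuous_const.clm_comp (continuous_Y.comp continuous_neg)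

theorem Winv_isometry (f : S1 → ell2) (hf : AEStronglyMeasurable f haarAddCircle) :
    eLpNorm (fun x : ℝ => (coord 0 ∘L Y (-x)) (f x)) 2 volume = eLpNorm f 2 haarAddCircle := by
  apply eLpNorm_two_congr
  have hm : AEStronglyMeasurable (fun x : ℝ => (coord 0 ∘L Y (-x)) (f x)) volume :=
    (ContinuousLinearMap.id ℂ (ell2 →L[ℂ] ℂ)).aestronglyMeasurable_comp₂
      continuous_coord_Y.aestronglyMeasurable (hf.comp_quasiMeasurePreserving quasi_coe)
  rw [lintegral_periodize _ (hm.enorm.pow_const 2), lintegral_circle]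
  congr 1 with x
  have h0 : ‖f x‖ₑ = ‖Y (-x) (f x)‖ₑ := by rw [← ofReal_norm, ← norm_Y (-x), ofReal_norm]
  rw [h0, ← tsum_enorm_sq, ← (Equiv.neg ℤ).tsum_eq (fun k : ℤ => ‖Y (-x) (f x) k‖ₑ ^ 2)]
  refine tsum_congr fun n => ?_
  have h1 : ((x + n : ℝ) : S1) = x := by
    rw [AddCircle.coe_add]
    simp
  have h2 : (-(x + n : ℝ)) = ((-n : ℤ) : ℝ) + -x := by push_cast; ring
  rw [h1, h2, ContinuousLinearMap.comp_apply, Y_add, coord_apply, Y_int, add_zero]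
  rfl

/-- The isometry `L²(S¹; ℓ²(ℤ)) → L²(ℝ)`, `g ↦ (x ↦ (Y_{-x} g(e^{2πix}))_0)`; it turns out to be the
inverse of `W`. -/
def WinvIso : L2S →ₗᵢ[ℂ] L2R :=
  pullIso quasi_coe continuous_coord_Y.aestronglyMeasurable Winv_isometry

theorem WinvIso_coe (g : L2S) : WinvIso g =ᵐ[volume] fun x : ℝ => Y (-x) (g (x : S1)) 0 :=
  pullIso_coe quasi_coe continuous_coord_Y.aestronglyMeasurable Winv_isometry g

/-- The representative in `(0, 1]` of a point of `ℝ/ℤ`. -/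
def rep (x : S1) : ℝ := (equivIoc (1 : ℝ) 0 x : ℝ)

theorem measurable_rep : Measurable rep :=
  measurable_subtype_coe.comp (measurableEquivIoc (1 : ℝ) 0).measurable

theorem coe_rep (x : S1) : ((rep x : ℝ) : S1) = x := coe_equivIoc

theorem rep_coe (y : ℝ) : ∃ m : ℤ, rep (y : S1) = y + m := by
  have h := coe_rep (y : S1)
  rw [← sub_eq_zero, ← AddCircle.coe_sub, AddCircle.coe_eq_zero_iff] at h
  obtain ⟨m, hm⟩ := h
  refine ⟨m, ?_⟩
  simp only [zsmul_eq_mul, mul_one] at hm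
  linarith

/-- The function of `L²(S¹; ℓ²(ℤ))` that `WinvIso` maps to the restriction of `u` to `(-j, 1 - j]`. -/
def piece (u : L2R) (j : ℤ) (x : S1) : ell2 := Y (rep x) (lp.single 2 j (u (rep x - j)))

theorem piece_memLp (u : L2R) (j : ℤ) : MemLp (piece u j) 2 (haarAddCircle : Measure S1) := by
  have hu : Measurable fun x : S1 => u (rep x - j) :=
    (Lp.stronglyMeasurable u).measurable.comp (measurable_rep.sub_const _)
  have h1 : AEStronglyMeasurable (fun x : S1 => (lp.single 2 j (u (rep x - j)) : ell2))
      haarAddCircle :=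
    (lp.isometry_single (E := fun _ : ℤ => ℂ) (p := 2) j).continuous.comp_aestronglyMeasurable
      hu.aestronglyMeasurable
  have h2 : AEStronglyMeasurable (fun x : S1 => Y (rep x)) haarAddCircle :=
    (continuous_Y.stronglyMeasurable.comp_measurable measurable_rep).aestronglyMeasurable
  refine ⟨(ContinuousLinearMap.id ℂ (ell2 →L[ℂ] ell2)).aestronglyMeasurable_comp₂ h2 h1, ?_⟩
  have h3 := Lp.eLpNorm_lt_top u
  rw [eLpNorm_lt_top_iff_lintegral_rpow_enorm_lt_top (by simp) (by simp)] at h3 ⊢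
  simp only [ENNReal.toReal_ofNat, ENNReal.rpow_ofNat] at h3 ⊢
  refine lt_of_le_of_lt ?_ h3
  rw [lintegral_circle, ← lintegral_sub_right_eq_self (fun x => ‖u x‖ₑ ^ 2) (j : ℝ)]
  refine (setLIntegral_mono' measurableSet_Ioc fun y hy => le_of_eq ?_).trans
    (setLIntegral_le_lintegral _ _)
  have hr : rep (y : S1) = y := by
    have hy' : y ∈ Set.Ioc (0 : ℝ) (0 + 1) := by simpa using hy
    rw [rep, equivIoc_coe_eq (p := (1 : ℝ)) hy']
  rw [piece, hr, ← ofReal_norm, norm_Y, lp.norm_single (by norm_num), ofReal_norm]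

theorem WinvIso_surjective : Function.Surjective WinvIso := by
  have hcl : IsClosed (Set.range WinvIso) := WinvIso.isometry.isClosedEmbedding.isClosed_range
  set K : Submodule ℂ L2R := LinearMap.range WinvIso.toLinearMap with hK
  have hKc : IsClosed (K : Set L2R) := hcl
  have : CompleteSpace K := hKc.completeSpace_coe
  have hbot : Kᗮ = ⊥ := by
    rw [Submodule.eq_bot_iff]
    intro u hu
    have hj : ∀ j : ℤ, ∀ᵐ y : ℝ, rep (y : S1) = y + j → u y = 0 := by
      intro j
      set g : L2S := (piece_memLp u j).toLp _ with hg
      have h0 : inner ℂ (WinvIso g) u = 0 := hu _ ⟨g, rfl⟩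
      have hval : ∀ᵐ y : ℝ, WinvIso g y = if rep (y : S1) = y + j then u y else 0 := by
        filter_upwards [WinvIso_coe g, quasi_coe.ae_eq_comp (piece_memLp u j).coeFn_toLp] with y h1 h2
        simp only [Function.comp_apply] at h2
        rw [h1, hg, h2, piece]
        obtain ⟨m, hm⟩ := rep_coe y
        rw [← Y_add, hm, show -y + (y + m) = (m : ℝ) by ring, Y_int, add_zero]
        by_cases hmj : m = j
        · subst hmj
          simp
        · rw [lp.single_apply_ne _ _ _ hmj, if_neg]
          intro h
          exact hmj (by exact_mod_cast add_left_cancel h)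
      have hint := L2.integrable_inner (𝕜 := ℂ) (WinvIso g) u
      rw [L2.inner_def] at h0
      have hpt : ∀ᵐ y : ℝ, inner ℂ (WinvIso g y) (u y) =
          ((if rep (y : S1) = y + j then ‖u y‖ ^ 2 else 0 : ℝ) : ℂ) := by
        filter_upwards [hval] with y hy
        rw [hy]
        split_ifs
        · rw [inner_self_eq_norm_sq_to_K]; push_cast; rfl
        · simp
      have hint' := (integrable_congr hpt).1 hint
      rw [integral_congr_ae hpt, integral_complex_ofReal, Complex.ofReal_eq_zero,
        integral_eq_zero_iff_of_nonneg (fun y => by dsimp; positivity)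
          (by simpa only [RCLike.re_to_complex, Complex.ofReal_re] using hint'.re)] at h0
      filter_upwards [h0] with y hy hr
      simp only [Pi.zero_apply] at hy
      rw [if_pos hr] at hy
      simpa using hy
    apply Lp.ext
    filter_upwards [ae_all_iff.2 hj, Lp.coeFn_zero ℂ 2 (volume : Measure ℝ)] with y hy h0
    rw [h0]
    obtain ⟨m, hm⟩ := rep_coe y
    exact hy m hm
  have htop : K = ⊤ := (Submodule.orthogonal_eq_bot_iff).1 hbot
  intro u
  have : u ∈ K := htop ▸ Submodule.mem_top
  exact this

/-- The unitary `W : L²(ℝ) → L²(S¹; ℓ²(ℤ))`, `(W u)(e^{2πiφ}) = Y_φ (u(φ - j))_j`; this formula is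
proved in `W_apply`. -/
def W : L2R ≃ₗᵢ[ℂ] L2S := (LinearIsometryEquiv.ofSurjective WinvIso WinvIso_surjective).symm

/-- The formula `(W u)(e^{2πiφ}) = Y_φ u^◇(φ)`, where `u^◇(φ) = (u(φ - j))_j`. -/
theorem W_apply (u : L2R) :
    ∀ᵐ φ : ℝ, ∃ v : ell2, (∀ j : ℤ, v j = u (φ - j)) ∧ W u (φ : S1) = Y φ v := by
  have h1 : WinvIso (W u) = u :=
    (LinearIsometryEquiv.ofSurjective WinvIso WinvIso_surjective).apply_symm_apply u
  have h2 := WinvIso_coe (W u)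
  rw [h1] at h2
  have h3 : ∀ᵐ φ : ℝ, ∀ j : ℤ, u (φ - j) = Y (-(φ - j)) (W u ((φ - j : ℝ) : S1)) 0 :=
    ae_all_iff.2 fun j =>
      (measurePreserving_sub_right (volume : Measure ℝ) (j : ℝ)).quasiMeasurePreserving.ae h2
  filter_upwards [h3] with φ h
  refine ⟨Y (-φ) (W u (φ : S1)), fun j => ?_, ?_⟩
  · have hc : ((φ - j : ℝ) : S1) = φ := by
      rw [AddCircle.coe_sub]
      simp
    rw [h j, hc, show -(φ - j) = (j : ℝ) + -φ by ring, Y_add, Y_int, add_zero]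
  · rw [← Y_add, add_neg_cancel, Y_zero]

theorem norm_diag_le (b : ℝ →ᵇ ℂ) (φ : ℝ) (v : ell2) (j : ℤ) :
    ‖b (j - φ) * v j‖ ≤ ‖(((‖b‖ : ℝ) : ℂ) • v : ell2) j‖ := by
  rw [lp.coeFn_smul, Pi.smul_apply, norm_mul, norm_smul, Complex.norm_real, norm_norm]
  exact mul_le_mul_of_nonneg_right (b.norm_coe_le_norm _) (norm_nonneg _)

/-- The operator `M^b_φ (a_j)_j = (b(j - φ) a_j)_j` on `ℓ²(ℤ)`. -/
def diagOp (b : ℝ →ᵇ ℂ) (φ : ℝ) : ell2 →L[ℂ] ell2 :=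
  LinearMap.mkContinuous
    { toFun := fun v => ⟨fun j => b (j - φ) * v j,
        (lp.memℓp (((‖b‖ : ℝ) : ℂ) • v)).mono' (norm_diag_le b φ v)⟩
      map_add' := fun v w => by ext j; exact mul_add _ _ _
      map_smul' := fun c v => by ext j; exact mul_left_comm _ _ _ } ‖b‖
    fun v => by
      refine (lp.norm_mono (p := 2) (by norm_num) (norm_diag_le b φ v)).trans ?_
      rw [norm_smul, Complex.norm_real, norm_norm]

/-- The operator `μ(g)` of multiplication by `g ∈ C(S¹, 𝓛(ℓ²(ℤ)))` on `L²(S¹; ℓ²(ℤ))`. -/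
def symbolMul (g : C(S1, ell2 →L[ℂ] ell2)) : L2S →L[ℂ] L2S :=
  (ContinuousLinearMap.id ℂ (ell2 →L[ℂ] ell2)).holderL haarAddCircle ∞ 2 2
    (g.toLp ∞ haarAddCircle ℂ)

theorem symbolMul_coe (g : C(S1, ell2 →L[ℂ] ell2)) (u : L2S) :
    symbolMul g u =ᵐ[haarAddCircle] fun x => g x (u x) := by
  have h := ContinuousLinearMap.coeFn_holder (r := 2)
    (ContinuousLinearMap.id ℂ (ell2 →L[ℂ] ell2)) (g.toLp ∞ haarAddCircle ℂ) u
  filter_upwards [h, ContinuousMap.coeFn_toLp (p := ∞) (𝕜 := ℂ) haarAddCircle g] with x hx h2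
  rw [symbolMul, ContinuousLinearMap.holderL_apply_apply, hx, h2]; rfl

/-- The restriction to `ℝ` of a continuous function on `[-∞, +∞]`. -/
def ofExtended (a : C(EReal, ℂ)) : ℝ →ᵇ ℂ :=
  (mkOfCompact a).compContinuous ⟨((↑) : ℝ → EReal), continuous_coe_real_ereal⟩

/-- The multiplication operator `f(M)` on `L²(ℝ)`. -/
def multOp (f : ℝ →ᵇ ℂ) : L2R →L[ℂ] L2R := mulOp f f.memLp_top

/-- The Fourier multiplier `b(D) = F⁻¹ b(M) F`. -/
def fourierMult (b : ℝ →ᵇ ℂ) : L2R →L[ℂ] L2R :=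
  (fourierL2.symm : L2R →L[ℂ] L2R) ∘L multOp b ∘L (fourierL2 : L2R →L[ℂ] L2R)

/-- The multiplications by `2π`-periodic continuous functions (these are automatically bounded) and
the Fourier multipliers `b(D)` with `b ∈ C[-∞, +∞]`. -/
def generatorsDiamond : Set (L2R →L[ℂ] L2R) :=
  {A | ∃ p : ℝ →ᵇ ℂ, Function.Periodic p (2 * Real.pi) ∧ A = multOp p} ∪
    {A | ∃ b : C(EReal, ℂ), A = fourierMult (ofExtended b)}

/-- The generators of the full algebra: those of `generatorsDiamond` together with the
multiplications `a(M)` with `a ∈ C[-∞, +∞]`. -/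
def generators : Set (L2R →L[ℂ] L2R) :=
  {A | ∃ a : C(EReal, ℂ), A = multOp (ofExtended a)} ∪ generatorsDiamond

/-- The C*-algebra `𝔄^◇`. -/
def algDiamond : StarSubalgebra ℂ (L2R →L[ℂ] L2R) :=
  (StarAlgebra.adjoin ℂ generatorsDiamond).topologicalClosure

/-- The C*-algebra `𝔄`. -/
def alg : StarSubalgebra ℂ (L2R →L[ℂ] L2R) :=
  (StarAlgebra.adjoin ℂ generators).topologicalClosure

theorem algDiamond_le_alg : algDiamond ≤ alg :=
  StarSubalgebra.topologicalClosure_mono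
    (StarAlgebra.adjoin_mono Set.subset_union_right)

theorem generators_subset_alg : generators ⊆ alg := fun _ hA =>
  StarSubalgebra.le_topologicalClosure _ (StarAlgebra.subset_adjoin ℂ _ hA)

/-- `a(M)`, for `a ∈ C[-∞, +∞]`, as an element of `𝔄`. -/
def multElt (a : C(EReal, ℂ)) : alg :=
  ⟨multOp (ofExtended a), generators_subset_alg (Or.inl ⟨a, rfl⟩)⟩

/-- The function `e_k(x) = e^{ikx}`. -/
def expFun (k : ℤ) : ℝ →ᵇ ℂ :=
  ofNormedAddCommGroup (fun x : ℝ => Complex.exp ((k * x : ℝ) * Complex.I)) (by fun_prop) 1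
    fun x => (Complex.norm_exp_ofReal_mul_I _).le

theorem expFun_periodic (k : ℤ) : Function.Periodic (expFun k) (2 * Real.pi) := by
  intro x
  change Complex.exp _ = Complex.exp _
  rw [Complex.exp_eq_exp_iff_exists_int]
  exact ⟨k, by push_cast; ring⟩

/-- `e_k(M)` as an element of `𝔄`. -/
def expElt (k : ℤ) : alg :=
  ⟨multOp (expFun k), generators_subset_alg (Or.inr (Or.inl ⟨_, expFun_periodic k, rfl⟩))⟩

/-- `b(D)`, for `b ∈ C[-∞, +∞]`, as an element of `𝔄`. -/
def fourierElt (b : C(EReal, ℂ)) : alg :=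
  ⟨fourierMult (ofExtended b), generators_subset_alg (Or.inr (Or.inr ⟨b, rfl⟩))⟩

/-- The C*-algebra `C(S*S¹, 𝓛(ℓ²(ℤ)))`. -/
abbrev SymbolAlg : Type := C(CoSphere, ell2 →L[ℂ] ell2)

/-- A shortcut to Mathlib's ring structure, for the sake of instance search. -/
instance instSemiringSymbolAlg : Semiring SymbolAlg :=
  ContinuousMap.instSemiringOfIsTopologicalSemiring

/-- A shortcut to Mathlib's star ring structure, for the sake of instance search. -/
instance instStarRingSymbolAlg : StarRing SymbolAlg :=
  ContinuousMap.instStarRingOfContinuousStar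

/-- A shortcut to Mathlib's algebra structure, for the sake of instance search. -/
instance instAlgebraSymbolAlg : Algebra ℂ SymbolAlg :=
  ContinuousMap.algebra

/-- `γ` takes on the generators of `𝔄` the values of the boundary principal symbol. -/
structure IsBoundarySymbol (γ : alg →⋆ₐ[ℂ] SymbolAlg) : Prop where
  mult_pos : ∀ (a : C(EReal, ℂ)) (x : S1), γ (multElt a) (x, 1) = a ⊤ • 1
  mult_neg : ∀ (a : C(EReal, ℂ)) (x : S1), γ (multElt a) (x, -1) = a ⊥ • 1
  exp : ∀ (k : ℤ) (v : CoSphere), γ (expElt k) v = Y (-k)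
  fourier : ∀ (b : C(EReal, ℂ)) (φ : ℝ) (s : ℤˣ),
    γ (fourierElt b) ((φ : S1), s) = Y φ ∘L diagOp (ofExtended b) φ ∘L Y (-φ)

/-- The restriction to `S¹ × {s}` of a function on the co-sphere bundle. -/
def restrictSide (s : ℤˣ) (g : SymbolAlg) : C(S1, ell2 →L[ℂ] ell2) :=
  g.comp ⟨fun x => (x, s), by fun_prop⟩

/-- The conjugation `T ↦ (F W⁻¹) T (F W⁻¹)⁻¹`. -/
def conjFW (T : L2S →L[ℂ] L2S) : L2R →L[ℂ] L2R :=
  ((W.symm.trans fourierL2 : L2S ≃ₗᵢ[ℂ] L2R) : L2S →L[ℂ] L2R) ∘L T ∘L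
    ((W.symm.trans fourierL2).symm : L2R →L[ℂ] L2S)

/-- The map `ι`: `μ ⊕ μ` followed by conjugation by `F W⁻¹ ⊕ F W⁻¹`. The first component belongs to
`S¹ × {-1}`, the second one to `S¹ × {+1}`. -/
def iota (g : SymbolAlg) : (L2R →L[ℂ] L2R) × (L2R →L[ℂ] L2R) :=
  (conjFW (symbolMul (restrictSide (-1) g)), conjFW (symbolMul (restrictSide 1 g)))

end PeriodicPsiDO

end

open PeriodicPsiDO

/-!
The operators in `𝔄` have limits along the translations by the multiples of `2π`. Conjugation by
such a translation fixes the multiplications by `2π`-periodic functions and the Fourier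
multipliers, hence all of `𝔄^◇`, and it turns `a(M)` into a shifted multiplication, which tends
strongly to `a(±∞) I` as the translation goes to `±∞`. The pairs (operator, limit) form a closed
star subalgebra (`isClosed_strongLimitGraph`) on which the first coordinate is injective, hence
isometric; its image is therefore closed, and it contains the generators of `𝔄`. So the two limits
exist on the whole of `𝔄` (`exists_limitHom`), and together they form `ψ`. It is surjective because
`𝔄` contains a multiplication `χ(M)` with `ψ(χ(M)) = (1, 0)`.

The map `ι` is an injective star homomorphism, and its image contains `𝔄^◇ ⊕ 𝔄^◇`: the
transformation `W` turns the symbol `Y_φ M^b_φ Y_{-φ}` into the multiplication by `b(-·)` and the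
symbol `Y_{-k}` into the translation by `k`, which the Fourier transform turns into `b(D)` and
`e_k(M)` (`sideHom_fourierSymbol`, `sideHom_const_Y`); an injective star homomorphism of
C*-algebras has closed image, and so these generators suffice. Hence `γ = ι⁻¹ ∘ ψ` is defined, and
its values on the generators are the ones just computed. It is unique because trigonometric
polynomials are dense among the periodic functions (`periodic_mem`), so that the operators on which
`γ` is prescribed generate `𝔄`.

For the compact operators, let `h` and `h'` be Schwartz functions and let `β` run through an
approximation of the delta function. Then `h(M) β(D) h'(M)*`, which belongs to the kernel of `ψ`
because `h` vanishes at infinity, converges in norm to a multiple of the operator of rank one given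
by `h` and `h'` (`norm_multOp_fourierMult_sub_le`). Schwartz functions are dense in `L²(ℝ)`, and
the operators of rank one span a dense subspace of the compact operators
(`mem_of_isCompactOperator`).
-/

noncomputable section
namespace PeriodicPsiDO

open Filter Topology

/-! ### C*-algebraic preliminaries -/

/-- A star homomorphism with values in the range of an injective one factors through it. -/
theorem exists_starAlgHom_lift {X Y Z : Type*} [Semiring X] [Algebra ℂ X] [Star X]
    [Semiring Y] [Algebra ℂ Y] [Star Y] [Semiring Z] [Algebra ℂ Z] [Star Z]
    (φ : X →⋆ₐ[ℂ] Y) (hφ : Function.Injective φ) (T : Z →⋆ₐ[ℂ] Y) (h : ∀ z, ∃ x, φ x = T z) :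
    ∃ ρ : Z →⋆ₐ[ℂ] X, ∀ z, φ (ρ z) = T z := by
  choose f hf using h
  exact ⟨{ toFun := f
           map_one' := hφ (by simp [hf])
           map_mul' := fun a b => hφ (by simp [hf])
           map_zero' := hφ (by simp [hf])
           map_add' := fun a b => hφ (by simp [hf])
           commutes' := fun c => hφ (by simp [hf, AlgHomClass.commutes])
           map_star' := fun a => hφ (by simp [hf, map_star]) }, hf⟩

/-- The range of an injective star homomorphism of C*-algebras is closed, since such a homomorphism
is isometric. -/
theorem isClosed_range_of_injective {X Y : Type*} [CStarAlgebra X] [CStarAlgebra Y]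
    (φ : X →⋆ₐ[ℂ] Y) (hφ : Function.Injective φ) : IsClosed (Set.range φ) := by
  have h : Isometry φ := AddMonoidHomClass.isometry_of_norm φ
    (fun x => NonUnitalStarAlgHom.norm_map φ hφ x)
  exact h.isClosedEmbedding.isClosed_range

section Graph

variable {A B : Type*} [CStarAlgebra A] [CStarAlgebra B] {Γ : StarSubalgebra ℂ (A × B)}

/-- If a star subalgebra `Γ` of `A × B` is the graph of a function, then the projection of `Γ` to
`A` is injective. -/
theorem fst_injective_of_graph (huniq : ∀ {a b b'}, (a, b) ∈ Γ → (a, b') ∈ Γ → b = b') :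
    Function.Injective ((StarAlgHom.fst ℂ A B).comp Γ.subtype) := by
  rintro ⟨⟨a, b⟩, h⟩ ⟨⟨a', b'⟩, h'⟩ haa
  obtain rfl : a = a' := haa
  obtain rfl := huniq h h'
  rfl

/-- The domain of a closed star subalgebra `Γ` of `A × B` that is the graph of a function is
closed. -/
theorem isClosed_map_fst_of_graph (hΓ : IsClosed (Γ : Set (A × B)))
    (huniq : ∀ {a b b'}, (a, b) ∈ Γ → (a, b') ∈ Γ → b = b') :
    IsClosed (Γ.map (StarAlgHom.fst ℂ A B) : Set A) := by
  let _ : CStarAlgebra Γ := StarSubalgebra.cstarAlgebra Γ (h_closed := hΓ)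
  have h := isClosed_range_of_injective _ (fst_injective_of_graph huniq)
  convert! h using 1
  ext a
  simp

/-- A star subalgebra of `A × B` that is the graph of a function defines a star homomorphism on any
star subalgebra of its domain. -/
theorem exists_starAlgHom_of_graph (huniq : ∀ {a b b'}, (a, b) ∈ Γ → (a, b') ∈ Γ → b = b')
    {Z : StarSubalgebra ℂ A} (hZ : Z ≤ Γ.map (StarAlgHom.fst ℂ A B)) :
    ∃ ρ : Z →⋆ₐ[ℂ] B, ∀ a : Z, ((a : A), ρ a) ∈ Γ := by
  obtain ⟨ρ, hρ⟩ := exists_starAlgHom_lift ((StarAlgHom.fst ℂ A B).comp Γ.subtype)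
    (fst_injective_of_graph huniq) Z.subtype fun a => by
      obtain ⟨p, hp, hpa⟩ := hZ a.2
      exact ⟨⟨p, hp⟩, hpa⟩
  refine ⟨((StarAlgHom.snd ℂ A B).comp Γ.subtype).comp ρ, fun a => ?_⟩
  have h : ((a : A), (ρ a).1.2) = (ρ a).1 := Prod.ext (hρ a).symm rfl
  exact h ▸ (ρ a).2

end Graph

/-- On a Hilbert space, a closed subspace of operators that contains the operators of rank one
contains the compact operators: if `P` is the projection onto the span of an `ε`-net of the image of
the unit ball under `K`, then `‖K - PK‖ ≤ ε`, and `PK` is a finite sum of operators of rank one. -/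
theorem mem_of_isCompactOperator {H : Type*} [NormedAddCommGroup H] [InnerProductSpace ℂ H]
    [CompleteSpace H] (J : Submodule ℂ (H →L[ℂ] H)) (hJ : IsClosed (J : Set (H →L[ℂ] H)))
    (h1 : ∀ x y : H, InnerProductSpace.rankOne ℂ x y ∈ J) {K : H →L[ℂ] H}
    (hK : IsCompactOperator K) : K ∈ J := by
  rw [← SetLike.mem_coe, ← hJ.closure_eq, Metric.mem_closure_iff]
  intro ε hε
  have hc : TotallyBounded (K '' Metric.closedBall 0 1) :=
    (hK.isCompact_closure_image_closedBall 1).totallyBounded.subset subset_closure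
  obtain ⟨t, ht, hcov⟩ := Metric.totallyBounded_iff.1 hc (ε / 2) (by positivity)
  set V : Submodule ℂ H := Submodule.span ℂ t
  have : FiniteDimensional ℂ V := FiniteDimensional.span_of_finite ℂ ht
  refine ⟨V.starProjection ∘L K, ?_, ?_⟩
  · have hsum : V.starProjection ∘L K = ∑ i, InnerProductSpace.rankOne ℂ
        ((stdOrthonormalBasis ℂ V i : V) : H) (ContinuousLinearMap.adjoint K
          ((stdOrthonormalBasis ℂ V i : V) : H)) := by
      ext x
      rw [ContinuousLinearMap.comp_apply, (stdOrthonormalBasis ℂ V).starProjection_eq_sum_rankOne]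
      simp [ContinuousLinearMap.adjoint_inner_left]
    rw [SetLike.mem_coe, hsum]
    exact J.sum_mem fun i _ => h1 _ _
  · rw [dist_eq_norm]
    refine lt_of_le_of_lt (ContinuousLinearMap.opNorm_le_of_unit_norm (C := ε / 2)
      (by positivity) fun x hx => ?_) (half_lt_self hε)
    -- The projection of `K x` is at least as close to `K x` as a point of the net.
    obtain ⟨y, hy, hxy⟩ : ∃ y ∈ t, dist (K x) y < ε / 2 := by
      simpa using hcov (Set.mem_image_of_mem K (by simp [hx.le] : x ∈ Metric.closedBall (0 : H) 1))
    rw [_root_.sub_apply, ContinuousLinearMap.comp_apply, Submodule.starProjection_minimal]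
    rw [dist_eq_norm] at hxy
    exact (ciInf_le ⟨0, by rintro _ ⟨z, rfl⟩; positivity⟩
      (⟨y, Submodule.subset_span hy⟩ : V)).trans hxy.le

/-! ### Multiplication operators -/

theorem multOp_coe (f : ℝ →ᵇ ℂ) (u : L2R) : multOp f u =ᵐ[volume] fun x => f x * u x :=
  mulOp_coe _ _ _

/-- The representation `f ↦ f(M)` of the bounded continuous functions on `L²(ℝ)`. -/
def multHom : (ℝ →ᵇ ℂ) →⋆ₐ[ℂ] (L2R →L[ℂ] L2R) where
  toFun := multOp
  map_one' := by
    ext1 u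
    apply Lp.ext
    filter_upwards [multOp_coe 1 u] with x h
    rw [h]; simp
  map_mul' f g := by
    ext1 u
    apply Lp.ext
    filter_upwards [multOp_coe (f * g) u, multOp_coe f (multOp g u), multOp_coe g u] with x h1 h2 h3
    rw [h1, mul_apply_eq_comp, h2, h3, BoundedContinuousFunction.mul_apply, mul_assoc]
  map_zero' := by
    ext1 u
    apply Lp.ext
    filter_upwards [multOp_coe 0 u, Lp.coeFn_zero ℂ 2 (volume : Measure ℝ)] with x h h0
    rw [h]
    exact (zero_mul _).trans h0.symm
  map_add' f g := by
    ext1 u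
    apply Lp.ext
    filter_upwards [multOp_coe (f + g) u, multOp_coe f u, multOp_coe g u,
      Lp.coeFn_add (multOp f u) (multOp g u)] with x h1 h2 h3 h4
    rw [h1]
    refine Eq.trans ?_ h4.symm
    rw [Pi.add_apply, h2, h3]
    exact add_mul _ _ _
  commutes' c := by
    ext1 u
    apply Lp.ext
    filter_upwards [multOp_coe (algebraMap ℂ (ℝ →ᵇ ℂ) c) u, Lp.coeFn_smul c u] with x h h1
    rw [h]
    exact Eq.trans (by simp) h1.symm
  map_star' f := by
    rw [ContinuousLinearMap.star_eq_adjoint, ContinuousLinearMap.eq_adjoint_iff]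
    intro u v
    rw [L2.inner_def, L2.inner_def]
    apply integral_congr_ae
    filter_upwards [multOp_coe (star f) u, multOp_coe f v] with x h1 h2
    rw [h1, h2]
    simp [mul_comm, mul_left_comm]

theorem multHom_apply (f : ℝ →ᵇ ℂ) : multHom f = multOp f := rfl

/-! ### Translations and the Fourier transform -/

/-- A closed property of functions in `L²(ℝ)` holds in general if it holds for Schwartz
functions. -/
theorem schwartz_induction {p : L2R → Prop} (hp : IsClosed {u | p u})
    (h : ∀ v : SchwartzMap ℝ ℂ, p (v.toLp 2 volume)) (u : L2R) : p u :=
  (SchwartzMap.denseRange_toLpCLM (F := ℂ) (E := ℝ) (p := 2) (μ := volume)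
    ENNReal.ofNat_ne_top).induction_on u hp h

/-- The translation `u ↦ u(· + t)` of `L²(ℝ)`. -/
def translation (t : ℝ) : L2R →L[ℂ] L2R :=
  (Lp.compMeasurePreservingₗᵢ ℂ (fun x : ℝ => x + t)
    (measurePreserving_add_right volume t)).toContinuousLinearMap

theorem translation_coe (t : ℝ) (u : L2R) : translation t u =ᵐ[volume] fun x => u (x + t) :=
  Lp.coeFn_compMeasurePreserving u (measurePreserving_add_right volume t)

theorem translation_add (s t : ℝ) (u : L2R) :
    translation s (translation t u) = translation (s + t) u := by
  apply Lp.ext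
  filter_upwards [translation_coe s (translation t u), translation_coe (s + t) u,
    (measurePreserving_add_right (volume : Measure ℝ) s).quasiMeasurePreserving.ae_eq_comp
      (translation_coe t u)] with x h1 h2 h3
  simp only [Function.comp_apply] at h3
  rw [h1, h3, h2, add_assoc]

theorem translation_zero (u : L2R) : translation 0 u = u := by
  apply Lp.ext
  filter_upwards [translation_coe 0 u] with x h
  rw [h, add_zero]

theorem inner_translation (t : ℝ) (u v : L2R) :
    inner ℂ (translation t u) v = inner ℂ u (translation (-t) v) := by
  have h : v = translation t (translation (-t) v) := by
    rw [translation_add, add_neg_cancel, translation_zero]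
  conv_lhs => rw [h]
  exact LinearIsometry.inner_map_map (𝕜 := ℂ) (E := L2R) (E' := L2R)
    (Lp.compMeasurePreservingₗᵢ ℂ (fun x : ℝ => x + t) (measurePreserving_add_right volume t)) _ _

theorem star_translation (t : ℝ) : star (translation t) = translation (-t) := by
  rw [ContinuousLinearMap.star_eq_adjoint, eq_comm, ContinuousLinearMap.eq_adjoint_iff]
  intro u v
  rw [inner_translation, neg_neg]

/-- The character `x ↦ e^{itx}`. -/
def character (t : ℝ) : ℝ →ᵇ ℂ :=
  ofNormedAddCommGroup (fun x : ℝ => Complex.exp ((t * x : ℝ) * Complex.I)) (by fun_prop) 1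
    fun x => (Complex.norm_exp_ofReal_mul_I _).le

theorem character_apply (t x : ℝ) :
    character t x = Complex.exp ((t * x : ℝ) * Complex.I) := rfl

theorem character_int (k : ℤ) : character k = expFun k := rfl

/-- The Fourier transform turns translations into multiplications by characters. -/
theorem fourierL2_translation (t : ℝ) (u : L2R) :
    fourierL2 (translation t u) = multOp (character t) (fourierL2 u) := by
  refine schwartz_induction (p := fun u => fourierL2 (translation t u) =
    multOp (character t) (fourierL2 u)) (isClosed_eq (by fun_prop) (by fun_prop)) (fun v => ?_) u
  have h1 : translation t (v.toLp 2 volume) = (v.compSubConstCLM ℂ (-t)).toLp 2 volume := by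
    apply Lp.ext
    filter_upwards [translation_coe t (v.toLp 2 volume),
      (measurePreserving_add_right (volume : Measure ℝ) t).quasiMeasurePreserving.ae_eq_comp
      (v.coeFn_toLp 2 volume), (v.compSubConstCLM ℂ (-t)).coeFn_toLp 2 volume] with x h1 h2 h3
    simp only [Function.comp_apply] at h2
    rw [h1, h2, h3]; simp
  rw [h1]
  apply Lp.ext
  filter_upwards [fourierL2_schwartz (v.compSubConstCLM ℂ (-t)), fourierL2_schwartz v,
    multOp_coe (character t) (fourierL2 (v.toLp 2 volume))] with ξ h2 h3 h4
  rw [h2, h4, h3, mul_left_comm]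
  congr 1
  rw [← integral_const_mul]
  refine Eq.trans ?_ (integral_sub_right_eq_self _ (-t))
  congr 1 with x
  rw [← mul_assoc, character_apply, ← Complex.exp_add, SchwartzMap.compSubConstCLM_apply]
  congr 2
  push_cast
  ring

/-- The reflection `u ↦ u(-·)` of `L²(ℝ)`. -/
def reflection : L2R →L[ℂ] L2R :=
  (Lp.compMeasurePreservingₗᵢ ℂ (fun x : ℝ => -x)
    (Measure.measurePreserving_neg volume)).toContinuousLinearMap

theorem reflection_coe (u : L2R) : reflection u =ᵐ[volume] fun x => u (-x) :=
  Lp.coeFn_compMeasurePreserving u (Measure.measurePreserving_neg volume)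

/-- The Fourier inversion formula, as the identity `F² = R` for the reflection `R`. -/
theorem fourierL2_fourierL2 (u : L2R) : fourierL2 (fourierL2 u) = reflection u := by
  refine schwartz_induction (p := fun u => fourierL2 (fourierL2 u) = reflection u)
    (isClosed_eq (by fun_prop) (by fun_prop)) (fun v => ?_) u
  set c : ℝ := (2 * Real.pi)⁻¹ with hc
  have hc0 : 0 < c := two_pi_inv_pos
  -- The Schwartz function that represents `F v`.
  set w : SchwartzMap ℝ ℂ := ((Real.sqrt c : ℝ) : ℂ) •
    SchwartzMap.compCLMOfContinuousLinearEquiv ℂ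
      (ContinuousLinearEquiv.smulLeft (Units.mk0 c hc0.ne')) (FourierTransform.fourier v) with hw
  have hwv : ∀ ξ, w ξ = (Real.sqrt c : ℂ) * FourierTransform.fourier (v : ℝ → ℂ) (c * ξ) := by
    intro ξ
    rw [← SchwartzMap.fourier_coe]
    rfl
  have h1 : fourierL2 (v.toLp 2 volume) = w.toLp 2 volume := by
    apply Lp.ext
    filter_upwards [fourierL2_schwartz v, w.coeFn_toLp 2 volume] with ξ h1 h2
    rw [h1, h2, hwv, Real.fourier_real_eq_integral_exp_smul]
    congr 2 with x
    rw [smul_eq_mul]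
    congr 2
    have := Real.pi_ne_zero
    rw [hc]
    push_cast
    field_simp
  rw [h1]
  apply Lp.ext
  filter_upwards [fourierL2_schwartz w, reflection_coe (v.toLp 2 volume),
    (Measure.measurePreserving_neg (volume : Measure ℝ)).quasiMeasurePreserving.ae_eq_comp
      (v.coeFn_toLp 2 volume)] with x h2 h3 h4
  simp only [Function.comp_apply] at h4
  rw [h2, h3, h4]
  have hinv : v (-x) =
      FourierTransformInv.fourierInv (FourierTransform.fourier (v : ℝ → ℂ)) (-x) := by
    rw [← SchwartzMap.fourier_coe, ← SchwartzMap.fourierInv_coe]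
    simp
  rw [hinv, Real.fourierInv_eq']
  -- The substitution `y = cx` turns the angular frequency into the one of Mathlib's transform.
  have hsub := Measure.integral_comp_mul_left
    (fun y : ℝ => Complex.exp (-(Complex.I * (c⁻¹ * y) * x)) *
      FourierTransform.fourier (v : ℝ → ℂ) y) c
  have h5 : ∀ y : ℝ, Complex.exp (-(Complex.I * y * x)) * w y =
      (Real.sqrt c : ℂ) * (Complex.exp (-(Complex.I * (c⁻¹ * (c * y : ℝ)) * x)) *
        FourierTransform.fourier (v : ℝ → ℂ) (c * y)) := by
    intro y
    have : (c⁻¹ * (c * y : ℝ) : ℂ) = y := by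
      rw [← Complex.ofReal_mul, inv_mul_cancel_left₀ hc0.ne']
    rw [hwv, this, mul_left_comm]
  simp_rw [h5]
  rw [integral_const_mul, hsub, ← mul_assoc, ← Complex.ofReal_mul, Real.mul_self_sqrt hc0.le,
    abs_of_pos (inv_pos.2 hc0), Complex.real_smul, ← mul_assoc, ← Complex.ofReal_mul,
    mul_inv_cancel₀ hc0.ne', Complex.ofReal_one, one_mul]
  congr 1 with y
  rw [smul_eq_mul, hc, inv_inv]
  congr 2
  simp
  ring

/-- By the inversion formula, the Fourier transform carries the multiplication by `b(-·)` to
`b(D)`. -/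
theorem fourierL2_multOp_symm (b b' : ℝ →ᵇ ℂ) (h : ∀ x, b' x = b (-x)) (u : L2R) :
    fourierL2 (multOp b' (fourierL2.symm u)) = fourierMult b u := by
  have key : ∀ v : L2R, reflection (multOp b' v) = multOp b (reflection v) := by
    intro v
    apply Lp.ext
    filter_upwards [reflection_coe (multOp b' v), multOp_coe b (reflection v), reflection_coe v,
      (Measure.measurePreserving_neg (volume : Measure ℝ)).quasiMeasurePreserving.ae_eq_comp
        (multOp_coe b' v)] with x h1 h2 h3 h4
    simp only [Function.comp_apply] at h4
    rw [h1, h4, h2, h3, h, neg_neg]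
  apply fourierL2.injective
  rw [fourierL2_fourierL2, key, ← fourierL2_fourierL2, LinearIsometryEquiv.apply_symm_apply]
  exact (fourierL2.apply_symm_apply _).symm

/-- Fourier multipliers commute with translations. -/
theorem fourierMult_translation (b : ℝ →ᵇ ℂ) (t : ℝ) (u : L2R) :
    fourierMult b (translation t u) = translation t (fourierMult b u) := by
  apply fourierL2.injective
  have h : ∀ v, fourierL2 (fourierMult b v) = multOp b (fourierL2 v) := fun v =>
    fourierL2.apply_symm_apply _
  rw [h, fourierL2_translation, fourierL2_translation, h, ← multHom_apply, ← multHom_apply,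
    ← mul_apply_eq_comp, ← map_mul, mul_comm, map_mul, mul_apply_eq_comp]

/-! ### The representation of the symbols on `L²(ℝ)` -/

/-- The C*-algebra `C(S¹, 𝓛(ℓ²(ℤ)))`. -/
abbrev CircleAlg : Type := C(S1, ell2 →L[ℂ] ell2)

/-- A shortcut to Mathlib's semiring structure, for the sake of instance search. -/
instance instSemiringCircleAlg : Semiring CircleAlg :=
  ContinuousMap.instSemiringOfIsTopologicalSemiring

/-- A shortcut to Mathlib's star ring structure, for the sake of instance search. -/
instance instStarRingCircleAlg : StarRing CircleAlg :=
  ContinuousMap.instStarRingOfContinuousStar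

/-- A shortcut to Mathlib's algebra structure, for the sake of instance search. -/
instance instAlgebraCircleAlg : Algebra ℂ CircleAlg :=
  ContinuousMap.algebra

theorem conjFW_apply (T : L2S →L[ℂ] L2S) (u : L2R) :
    conjFW T u = fourierL2 (W.symm (T (W (fourierL2.symm u)))) := rfl

/-- The representation `g ↦ μ(g)` of `C(S¹, 𝓛(ℓ²(ℤ)))` on `L²(S¹; ℓ²(ℤ))`. -/
def symbolHom : CircleAlg →⋆ₐ[ℂ] (L2S →L[ℂ] L2S) where
  toFun := symbolMul
  map_one' := by
    ext1 u
    apply Lp.ext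
    filter_upwards [symbolMul_coe 1 u] with x h
    rw [h]; rfl
  map_mul' f g := by
    ext1 u
    apply Lp.ext
    filter_upwards [symbolMul_coe (f * g) u, symbolMul_coe f (symbolMul g u),
      symbolMul_coe g u] with x h1 h2 h3
    rw [h1, mul_apply_eq_comp, h2, h3]; rfl
  map_zero' := by
    ext1 u
    apply Lp.ext
    filter_upwards [symbolMul_coe 0 u,
      Lp.coeFn_zero ell2 2 (haarAddCircle : Measure S1)] with x h h0
    rw [h]
    exact Eq.trans rfl h0.symm
  map_add' f g := by
    ext1 u
    apply Lp.ext
    filter_upwards [symbolMul_coe (f + g) u, symbolMul_coe f u, symbolMul_coe g u,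
      Lp.coeFn_add (symbolMul f u) (symbolMul g u)] with x h1 h2 h3 h4
    rw [h1]
    refine Eq.trans ?_ h4.symm
    rw [Pi.add_apply, h2, h3]
    rfl
  commutes' c := by
    ext1 u
    apply Lp.ext
    filter_upwards [symbolMul_coe (c • (1 : CircleAlg)) u,
      Lp.coeFn_smul c u] with x h h1
    exact h.trans (Eq.trans rfl h1.symm)
  map_star' f := by
    rw [ContinuousLinearMap.star_eq_adjoint, ContinuousLinearMap.eq_adjoint_iff]
    intro u v
    rw [L2.inner_def, L2.inner_def]
    apply integral_congr_ae
    filter_upwards [symbolMul_coe (star f) u, symbolMul_coe f v] with x h1 h2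
    rw [h1, h2, ContinuousMap.star_apply, ContinuousLinearMap.star_eq_adjoint,
      ContinuousLinearMap.adjoint_inner_left]

/-- A continuous symbol is determined by its action on the constant functions in `L²(S¹; ℓ²(ℤ))`. -/
theorem symbolHom_injective : Function.Injective symbolHom := by
  rw [injective_iff_map_eq_zero]
  intro g hg
  ext1 x
  ext1 v
  have h : (fun x => g x v) =ᵐ[(haarAddCircle : Measure S1)] fun _ => 0 := by
    have h1 : symbolMul g ((memLp_const v).toLp (fun _ : S1 => v)) = 0 := by
      change symbolHom g _ = 0
      rw [hg]; rfl
    filter_upwards [symbolMul_coe g ((memLp_const v).toLp (fun _ : S1 => v)),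
      (memLp_const v : MemLp (fun _ : S1 => v) 2 haarAddCircle).coeFn_toLp,
      Lp.coeFn_zero ell2 2 (haarAddCircle : Measure S1)] with x h2 h3 h4
    rw [h1, h4, h3] at h2
    exact h2.symm
  have h2 := (Continuous.ae_eq_iff_eq (haarAddCircle : Measure S1) (by fun_prop)
    continuous_const).1 h
  exact congrFun h2 x

/-- The representation `g ↦ F W⁻¹ μ(g) W F⁻¹` of `C(S¹, 𝓛(ℓ²(ℤ)))` on `L²(ℝ)`. -/
def sideHom : CircleAlg →⋆ₐ[ℂ] (L2R →L[ℂ] L2R) :=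
  ((W.symm.trans fourierL2).conjStarAlgEquiv :
    (L2S →L[ℂ] L2S) →⋆ₐ[ℂ] (L2R →L[ℂ] L2R)).comp symbolHom

theorem sideHom_apply (g : CircleAlg) : sideHom g = conjFW (symbolMul g) := rfl

theorem sideHom_injective : Function.Injective sideHom :=
  (W.symm.trans fourierL2).conjStarAlgEquiv.injective.comp symbolHom_injective

theorem W_symm_coe (g : L2S) : W.symm g =ᵐ[volume] fun x : ℝ => Y (-x) (g (x : S1)) 0 :=
  WinvIso_coe g

theorem W_symm_symbolMul (g : CircleAlg) (u : L2S) :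
    W.symm (symbolMul g u) =ᵐ[volume] fun x : ℝ => Y (-x) (g (x : S1) (u (x : S1))) 0 := by
  filter_upwards [W_symm_coe (symbolMul g u), quasi_coe.ae_eq_comp (symbolMul_coe g u)] with x h1 h2
  simp only [Function.comp_apply] at h2
  rw [h1, h2]

/-- The constant symbol `Y_{-k}` represents the multiplication by `e_k`: under `W` it is the
translation `u ↦ u(· + k)`, which the Fourier transform turns into that multiplication. -/
theorem sideHom_const_Y (k : ℤ) :
    sideHom (ContinuousMap.const S1 (Y (-k))) = multOp (expFun k) := by
  ext1 u
  have h : ∀ v : L2S, W.symm (symbolMul (ContinuousMap.const S1 (Y (-k))) v) =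
      translation k (W.symm v) := by
    intro v
    apply Lp.ext
    filter_upwards [W_symm_symbolMul (ContinuousMap.const S1 (Y (-k))) v,
      translation_coe k (W.symm v),
      (measurePreserving_add_right (volume : Measure ℝ) (k : ℝ)).quasiMeasurePreserving.ae_eq_comp
        (W_symm_coe v)] with x h1 h2 h3
    simp only [Function.comp_apply] at h3
    have hc : ((x + k : ℝ) : S1) = x := by
      rw [AddCircle.coe_add]
      simp
    rw [h1, h2, h3, hc, ContinuousMap.const_apply, ← Y_add, neg_add]
  rw [sideHom_apply, conjFW_apply, h, fourierL2_translation, LinearIsometryEquiv.symm_apply_apply,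
    LinearIsometryEquiv.apply_symm_apply, character_int]

theorem diagOp_apply (b : ℝ →ᵇ ℂ) (φ : ℝ) (v : ell2) (j : ℤ) : diagOp b φ v j = b (j - φ) * v j :=
  rfl

/-- This relation makes `Y_φ M^b_φ Y_{-φ}` periodic in `φ`. -/
theorem diagOp_shift (b : ℝ →ᵇ ℂ) (φ : ℝ) (n : ℤ) :
    Y n ∘L diagOp b (φ + n) ∘L Y (-n) = diagOp b φ := by
  ext v j
  have h : (-(n : ℝ)) = ((-n : ℤ) : ℝ) := by push_cast; rfl
  simp only [ContinuousLinearMap.comp_apply]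
  rw [Y_int, diagOp_apply, diagOp_apply, h, Y_int, neg_add_cancel_left]
  congr 2
  push_cast
  ring

/-- Functions in `C[-∞, +∞]` are uniformly continuous on `ℝ`. -/
theorem uniformContinuous_ofExtended (b : C(EReal, ℂ)) : UniformContinuous (ofExtended b) := by
  -- Subtracting a multiple of the Lipschitz step function `s` makes the two limits at `±∞` equal.
  set β : ℂ := (b ⊤ - b ⊥) / 2 with hβ
  set s : ℝ → ℂ := fun x => ((max (min x 1) (-1) : ℝ) : ℂ) with hs
  have hsu : UniformContinuous s :=
    (Complex.isometry_ofReal.lipschitz.comp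
      ((LipschitzWith.id.min_const 1).max_const (-1))).uniformContinuous
  have hsmul : UniformContinuous fun x => β * s x := hsu.const_mul' β
  have hf : UniformContinuous fun x => ofExtended b x - β * s x := by
    refine Continuous.uniformContinuous_of_tendsto_cocompact (x := (b ⊤ + b ⊥) / 2)
      ((ofExtended b).continuous.sub hsmul.continuous) ?_
    rw [cocompact_eq_atBot_atTop, tendsto_sup]
    have hb : ∀ {l : Filter ℝ} {e : EReal} {r : ℂ}, Tendsto ((↑) : ℝ → EReal) l (𝓝 e) →
        (∀ᶠ x in l, s x = r) →
        Tendsto (fun x => ofExtended b x - β * s x) l (𝓝 (b e - β * r)) := by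
      intro l e r hl hr
      refine ((b.continuous.tendsto e).comp hl).sub (tendsto_const_nhds.mul ?_)
      exact tendsto_const_nhds.congr' (hr.mono fun x hx => hx.symm)
    constructor
    · convert! hb (r := -1) EReal.tendsto_coe_atBot ?_ using 2
      · rw [hβ]; ring
      · filter_upwards [eventually_le_atBot (-1 : ℝ)] with x hx
        rw [hs]
        simp [min_eq_left (hx.trans (by norm_num : (-1 : ℝ) ≤ 1)), hx]
    · convert! hb (r := 1) EReal.tendsto_coe_atTop ?_ using 2
      · rw [hβ]; ring
      · filter_upwards [eventually_ge_atTop (1 : ℝ)] with x hx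
        rw [hs]
        simp [hx]
  convert! hf.add hsmul using 2 with x
  ring

theorem continuous_diagOp (b : C(EReal, ℂ)) : Continuous (diagOp (ofExtended b)) := by
  rw [Metric.continuous_iff]
  intro χ ε hε
  obtain ⟨δ, hδ, h⟩ := Metric.uniformContinuous_iff.1 (uniformContinuous_ofExtended b) (ε / 2)
    (by positivity)
  refine ⟨δ, hδ, fun φ hφ => ?_⟩
  rw [dist_eq_norm]
  refine lt_of_le_of_lt (ContinuousLinearMap.opNorm_le_bound _ (by positivity : 0 ≤ ε / 2)
    fun v => ?_) (half_lt_self hε)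
  have h2 : ∀ j : ℤ, ‖((diagOp (ofExtended b) φ - diagOp (ofExtended b) χ) v : ell2) j‖ ≤
      ‖((((ε / 2 : ℝ) : ℂ)) • v : ell2) j‖ := by
    intro j
    have h3 : ((diagOp (ofExtended b) φ - diagOp (ofExtended b) χ) v : ell2) j =
        (ofExtended b (j - φ) - ofExtended b (j - χ)) * v j := by
      rw [sub_mul]; rfl
    rw [h3, lp.coeFn_smul, Pi.smul_apply, norm_mul, norm_smul, Complex.norm_real,
      Real.norm_of_nonneg (by positivity)]
    refine mul_le_mul_of_nonneg_right ?_ (norm_nonneg _)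
    rw [← dist_eq_norm]
    exact (h (by rwa [dist_sub_left])).le
  refine (lp.norm_mono (p := 2) (by norm_num) h2).trans ?_
  rw [norm_smul, Complex.norm_real, Real.norm_of_nonneg (by positivity)]

theorem periodic_fourierSymbol (b : ℝ →ᵇ ℂ) :
    Function.Periodic (fun φ : ℝ => Y φ ∘L diagOp b φ ∘L Y (-φ)) 1 := by
  intro φ
  ext1 v
  have h := congrArg (fun T : ell2 →L[ℂ] ell2 => T (Y (-φ) v)) (diagOp_shift b φ 1)
  simp only [ContinuousLinearMap.comp_apply, Int.cast_one] at h ⊢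
  rw [← h, ← Y_add, ← Y_add, neg_add_rev]

/-- The symbol `e^{2πiφ} ↦ Y_φ M^b_φ Y_{-φ}` of `b(D)`. -/
def fourierSymbol (b : C(EReal, ℂ)) : CircleAlg where
  toFun := (periodic_fourierSymbol (ofExtended b)).lift
  continuous_toFun := continuous_coinduced_dom.2 <|
    continuous_Y.clm_comp ((continuous_diagOp b).clm_comp (continuous_Y.comp continuous_neg))

theorem fourierSymbol_coe (b : C(EReal, ℂ)) (φ : ℝ) :
    fourierSymbol b (φ : S1) = Y φ ∘L diagOp (ofExtended b) φ ∘L Y (-φ) := rfl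

/-- The symbol `e^{2πiφ} ↦ Y_φ M^b_φ Y_{-φ}` represents `b(D)`: under `W` it is the multiplication
by `b(-·)`, which the Fourier transform carries to `b(D)`. -/
theorem sideHom_fourierSymbol (b : C(EReal, ℂ)) :
    sideHom (fourierSymbol b) = fourierMult (ofExtended b) := by
  ext1 u
  set b' : ℝ →ᵇ ℂ := (ofExtended b).compContinuous ⟨fun x => -x, continuous_neg⟩
  have h : ∀ v : L2S, W.symm (symbolMul (fourierSymbol b) v) = multOp b' (W.symm v) := by
    intro v
    apply Lp.ext
    filter_upwards [W_symm_symbolMul (fourierSymbol b) v, multOp_coe b' (W.symm v),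
        W_symm_coe v] with x h1 h2 h3
    rw [h1, h2, h3, fourierSymbol_coe, ContinuousLinearMap.comp_apply,
      ContinuousLinearMap.comp_apply, ← Y_add, neg_add_cancel, Y_zero, diagOp_apply]
    simp [b']
  rw [sideHom_apply, conjFW_apply, h, LinearIsometryEquiv.symm_apply_apply]
  exact fourierL2_multOp_symm _ _ (fun x => rfl) u

/-! ### Generators of the algebras -/

theorem isClosed_algDiamond : IsClosed (algDiamond : Set (L2R →L[ℂ] L2R)) :=
  StarSubalgebra.isClosed_topologicalClosure _

theorem isClosed_alg : IsClosed (alg : Set (L2R →L[ℂ] L2R)) :=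
  StarSubalgebra.isClosed_topologicalClosure _

instance instCStarAlgebraAlgDiamond : CStarAlgebra algDiamond :=
  StarSubalgebra.cstarAlgebra algDiamond (h_closed := isClosed_algDiamond)

instance instCStarAlgebraAlg : CStarAlgebra alg :=
  StarSubalgebra.cstarAlgebra alg (h_closed := isClosed_alg)

theorem continuous_starAlgHom {X Y : Type*} [CStarAlgebra X] [CStarAlgebra Y]
    (φ : X →⋆ₐ[ℂ] Y) : Continuous φ :=
  AddMonoidHomClass.continuous_of_bound φ 1 fun x => by
    rw [one_mul]; exact NonUnitalStarAlgHom.norm_apply_le φ x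

instance factTwoPiPos : Fact (0 < 2 * Real.pi) := ⟨Real.two_pi_pos⟩

/-- Multiplication by a periodic function, as a linear function of that function on the circle. -/
def periodicMult : C(AddCircle (2 * Real.pi), ℂ) →ₗ[ℂ] (L2R →L[ℂ] L2R) where
  toFun f := multHom ((mkOfCompact f).compContinuous ⟨_, AddCircle.continuous_mk' (2 * Real.pi)⟩)
  map_add' f g := by rw [← map_add]; rfl
  map_smul' c f := by rw [RingHom.id_apply, ← map_smul]; rfl

theorem continuous_periodicMult : Continuous periodicMult := by
  exact (continuous_starAlgHom multHom).comp ((continuous_compContinuous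
    ⟨_, AddCircle.continuous_mk' (2 * Real.pi)⟩).comp
    (ContinuousMap.linearIsometryBoundedOfCompact (AddCircle (2 * Real.pi)) ℂ ℂ).continuous)

/-- Trigonometric polynomials are dense among the continuous `2π`-periodic functions, so that the
multiplications by characters produce all the multiplications by such functions. -/
theorem periodic_mem {S : StarSubalgebra ℂ (L2R →L[ℂ] L2R)}
    (hS : IsClosed (S : Set (L2R →L[ℂ] L2R))) (h : ∀ k, multOp (expFun k) ∈ S) {p : ℝ →ᵇ ℂ}
    (hp : Function.Periodic p (2 * Real.pi)) : multOp p ∈ S := by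
  set T : Submodule ℂ C(AddCircle (2 * Real.pi), ℂ) :=
    (Subalgebra.toSubmodule S.toSubalgebra).comap periodicMult
  have hT : IsClosed (T : Set C(AddCircle (2 * Real.pi), ℂ)) := hS.preimage continuous_periodicMult
  have h1 : Submodule.span ℂ (Set.range (fourier (T := 2 * Real.pi))) ≤ T := by
    rw [Submodule.span_le]
    rintro _ ⟨k, rfl⟩
    change multOp _ ∈ S
    convert! h k using 2
    ext x
    change fourier k ((x : ℝ) : AddCircle (2 * Real.pi)) = Complex.exp _
    rw [fourier_coe_apply]
    congr 1
    have := Real.pi_ne_zero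
    push_cast
    field_simp
  have h2 := Submodule.topologicalClosure_minimal _ h1 hT
  rw [span_fourier_closure_eq_top] at h2
  have h3 : (⟨hp.lift, continuous_coinduced_dom.2 p.continuous⟩ :
    C(AddCircle (2 * Real.pi), ℂ)) ∈ T := h2 Submodule.mem_top
  exact h3

theorem algDiamond_le_of_mem {S : StarSubalgebra ℂ (L2R →L[ℂ] L2R)}
    (hS : IsClosed (S : Set (L2R →L[ℂ] L2R))) (h1 : ∀ k, multOp (expFun k) ∈ S)
    (h2 : ∀ b, fourierMult (ofExtended b) ∈ S) : algDiamond ≤ S := by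
  refine StarSubalgebra.topologicalClosure_minimal (StarAlgebra.adjoin_le ?_) hS
  rintro _ (⟨p, hp, rfl⟩ | ⟨b, rfl⟩)
  · exact periodic_mem hS h1 hp
  · exact h2 b

theorem alg_le_of_mem {S : StarSubalgebra ℂ (L2R →L[ℂ] L2R)}
    (hS : IsClosed (S : Set (L2R →L[ℂ] L2R))) (h0 : ∀ a, multOp (ofExtended a) ∈ S)
    (h1 : ∀ k, multOp (expFun k) ∈ S) (h2 : ∀ b, fourierMult (ofExtended b) ∈ S) : alg ≤ S := by
  refine StarSubalgebra.topologicalClosure_minimal (StarAlgebra.adjoin_le ?_) hS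
  rintro _ (⟨a, rfl⟩ | ⟨p, hp, rfl⟩ | ⟨b, rfl⟩)
  · exact h0 a
  · exact periodic_mem hS h1 hp
  · exact h2 b

/-- A star homomorphism on `𝔄` is determined by its values on the generators. -/
theorem alg_hom_ext {Y : Type*} [CStarAlgebra Y] {f g : alg →⋆ₐ[ℂ] Y}
    (h0 : ∀ a, f (multElt a) = g (multElt a)) (h1 : ∀ k, f (expElt k) = g (expElt k))
    (h2 : ∀ b, f (fourierElt b) = g (fourierElt b)) : f = g := by
  -- The operators on which `f` and `g` agree.
  set S : StarSubalgebra ℂ (L2R →L[ℂ] L2R) := (StarAlgHom.equalizer f g).map alg.subtype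
  have hS : IsClosed (S : Set (L2R →L[ℂ] L2R)) :=
    isClosed_alg.isClosedEmbedding_subtypeVal.isClosedMap _
      (isClosed_eq (continuous_starAlgHom f) (continuous_starAlgHom g))
  have h : alg ≤ S := alg_le_of_mem hS (fun a => ⟨multElt a, h0 a, rfl⟩)
    (fun k => ⟨expElt k, h1 k, rfl⟩) (fun b => ⟨fourierElt b, h2 b, rfl⟩)
  ext1 A
  obtain ⟨B, hB, hBA⟩ := h A.2
  rwa [← Subtype.ext hBA]

/-! ### Strong limits of star homomorphisms -/

section StrongLimit

variable {H ι : Type*} [NormedAddCommGroup H] [InnerProductSpace ℂ H] [CompleteSpace H]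

/-- The pairs `(A, B)` of operators such that `Φ i A` tends strongly to `B`, and `Φ i A*` to `B*`.
The second condition is there because taking adjoints is not strongly continuous. -/
def strongLimitGraph (Φ : ι → (H →L[ℂ] H) →⋆ₐ[ℂ] (H →L[ℂ] H)) (l : Filter ι) :
    StarSubalgebra ℂ ((H →L[ℂ] H) × (H →L[ℂ] H)) where
  carrier := {P | (∀ u, Tendsto (fun i => Φ i P.1 u) l (𝓝 (P.2 u))) ∧
    ∀ u, Tendsto (fun i => Φ i (star P.1) u) l (𝓝 (star P.2 u))}
  mul_mem' := by
    have key : ∀ {A A' B B' : H →L[ℂ] H}, (∀ u, Tendsto (fun i => Φ i A u) l (𝓝 (B u))) →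
        (∀ u, Tendsto (fun i => Φ i A' u) l (𝓝 (B' u))) →
        ∀ u, Tendsto (fun i => Φ i (A * A') u) l (𝓝 ((B * B') u)) := by
      intro A A' B B' h h' u
      have h1 : Tendsto (fun i => Φ i A (Φ i A' u - B' u)) l (𝓝 0) := by
        have h2 : Tendsto (fun i => ‖A‖ * ‖Φ i A' u - B' u‖) l (𝓝 0) := by
          have := ((h' u).sub_const (B' u)).norm.const_mul ‖A‖
          simpa using this
        refine squeeze_zero_norm (fun i => ?_) h2
        exact (ContinuousLinearMap.le_opNorm _ _).trans (mul_le_mul_of_nonneg_right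
          (NonUnitalStarAlgHom.norm_apply_le (Φ i) A) (norm_nonneg _))
      have h3 := h1.add (h (B' u))
      simpa [mul_apply_eq_comp] using h3
    rintro ⟨A, B⟩ ⟨A', B'⟩ ⟨h1, h2⟩ ⟨h1', h2'⟩
    refine ⟨key h1 h1', ?_⟩
    simp only [Prod.mk_mul_mk, star_mul]
    exact key h2' h2
  add_mem' := by
    rintro ⟨A, B⟩ ⟨A', B'⟩ ⟨h1, h2⟩ ⟨h1', h2'⟩
    constructor
    · intro u
      simpa using (h1 u).add (h1' u)
    · intro u
      simpa using (h2 u).add (h2' u)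
  algebraMap_mem' c := by
    constructor
    · intro u
      simpa [AlgHomClass.commutes] using tendsto_const_nhds
    · intro u
      simpa [← algebraMap_star_comm, AlgHomClass.commutes] using tendsto_const_nhds
  star_mem' := by
    rintro ⟨A, B⟩ ⟨h1, h2⟩
    exact ⟨h2, by simpa using h1⟩

theorem mem_strongLimitGraph {Φ : ι → (H →L[ℂ] H) →⋆ₐ[ℂ] (H →L[ℂ] H)} {l : Filter ι}
    {P : (H →L[ℂ] H) × (H →L[ℂ] H)} : P ∈ strongLimitGraph Φ l ↔
      (∀ u, Tendsto (fun i => Φ i P.1 u) l (𝓝 (P.2 u))) ∧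
        ∀ u, Tendsto (fun i => Φ i (star P.1) u) l (𝓝 (star P.2 u)) := Iff.rfl

/-- The graph is closed, since the homomorphisms `Φ i` are contractions. -/
theorem isClosed_strongLimitGraph (Φ : ι → (H →L[ℂ] H) →⋆ₐ[ℂ] (H →L[ℂ] H)) (l : Filter ι) :
    IsClosed (strongLimitGraph Φ l : Set ((H →L[ℂ] H) × (H →L[ℂ] H))) := by
  have key : IsClosed {P : (H →L[ℂ] H) × (H →L[ℂ] H) |
      ∀ u, Tendsto (fun i => Φ i P.1 u) l (𝓝 (P.2 u))} := by
    rw [← isSeqClosed_iff_isClosed]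
    intro P Q hP hPQ u
    have h1 : Tendsto (fun n => (‖Q.1 - (P n).1‖ + ‖Q.2 - (P n).2‖) * ‖u‖) atTop (𝓝 0) := by
      have h1 := (tendsto_const_nhds (x := Q.1)).sub (hPQ.fst_nhds)
      have h2 := (tendsto_const_nhds (x := Q.2)).sub (hPQ.snd_nhds)
      simpa using (h1.norm.add h2.norm).mul_const ‖u‖
    rw [tendsto_iff_norm_sub_tendsto_zero, Metric.tendsto_nhds]
    intro ε hε
    obtain ⟨n, hn⟩ := ((tendsto_order.1 h1).2 (ε / 2) (by positivity)).exists
    have h2 := tendsto_iff_norm_sub_tendsto_zero.1 (hP n u)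
    filter_upwards [(tendsto_order.1 h2).2 (ε / 2) (by positivity)] with i hi
    rw [Real.dist_eq, sub_zero, abs_norm]
    have h3 : Φ i Q.1 u - Q.2 u = Φ i (Q.1 - (P n).1) u + (Φ i (P n).1 u - (P n).2 u) +
        -((Q.2 - (P n).2) u) := by
      simp only [map_sub, _root_.sub_apply]
      abel
    have h4 : ‖Φ i (Q.1 - (P n).1) u‖ ≤ ‖Q.1 - (P n).1‖ * ‖u‖ :=
      (ContinuousLinearMap.le_opNorm _ _).trans (mul_le_mul_of_nonneg_right
          (NonUnitalStarAlgHom.norm_apply_le (Φ i) _) (norm_nonneg _))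
    have h5 : ‖-((Q.2 - (P n).2) u)‖ ≤ ‖Q.2 - (P n).2‖ * ‖u‖ := by
      rw [norm_neg]
      exact ContinuousLinearMap.le_opNorm _ _
    rw [h3]
    have h6 := norm_add₃_le (a := Φ i (Q.1 - (P n).1) u) (b := Φ i (P n).1 u - (P n).2 u)
      (c := -((Q.2 - (P n).2) u))
    linarith
  exact key.inter (key.preimage continuous_star)

end StrongLimit

/-- Bounded pointwise convergence of functions implies strong convergence of the multiplication
operators, by dominated convergence. -/
theorem tendsto_multOp {ι : Type*} {l : Filter ι} [l.IsCountablyGenerated] {f : ι → ℝ →ᵇ ℂ}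
    {g : ℝ →ᵇ ℂ} {C : ℝ} (hC : ∀ i, ‖f i‖ ≤ C) (h : ∀ x, Tendsto (fun i => f i x) l (𝓝 (g x)))
    (u : L2R) : Tendsto (fun i => multOp (f i) u) l (𝓝 (multOp g u)) := by
  rw [Lp.tendsto_Lp_iff_tendsto_eLpNorm']
  have hae : ∀ i, ⇑(multOp (f i) u) - ⇑(multOp g u) =ᵐ[volume]
      fun x => (f i x - g x) * u x := by
    intro i
    filter_upwards [multOp_coe (f i) u, multOp_coe g u] with x h1 h2
    rw [Pi.sub_apply, h1, h2, sub_mul]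
  have h2 : Tendsto (fun i => ∫⁻ x, ‖(f i x - g x) * u x‖ₑ ^ 2) l (𝓝 (∫⁻ _ : ℝ, 0)) := by
    refine tendsto_lintegral_filter_of_dominated_convergence
      (fun x => ENNReal.ofReal (C + ‖g‖) ^ 2 * ‖u x‖ₑ ^ 2) ?_ ?_ ?_ ?_
    · refine Eventually.of_forall fun i => ?_
      have := (Lp.stronglyMeasurable u).measurable
      have h1 := (f i).continuous.measurable
      have h2 := g.continuous.measurable
      fun_prop
    · refine Eventually.of_forall fun i => Eventually.of_forall fun x => ?_
      rw [enorm_mul, mul_pow]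
      gcongr
      rw [← ofReal_norm]
      refine ENNReal.ofReal_le_ofReal
        ((norm_sub_le _ _).trans (add_le_add ?_ (g.norm_coe_le_norm x)))
      exact ((f i).norm_coe_le_norm x).trans (hC i)
    · have h3 := Lp.eLpNorm_lt_top u
      rw [eLpNorm_lt_top_iff_lintegral_rpow_enorm_lt_top (by simp) (by simp)] at h3
      simp only [ENNReal.toReal_ofNat, ENNReal.rpow_ofNat] at h3
      rw [lintegral_const_mul' _ _ (by finiteness)]
      exact ENNReal.mul_ne_top (by finiteness) h3.ne
    · refine Eventually.of_forall fun x => ?_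
      have h3 : Tendsto (fun i => ‖(f i x - g x) * u x‖ₑ ^ 2) l (𝓝 (‖(g x - g x) * u x‖ₑ ^ 2)) :=
        ((ENNReal.continuous_pow 2).tendsto _).comp
          (((h x).sub_const (g x)).mul_const (u x)).enorm
      simpa using h3
  have h3 := ((ENNReal.continuous_rpow_const (y := (1 / 2 : ℝ))).tendsto _).comp h2
  have h4 : (fun i => eLpNorm (⇑(multOp (f i) u) - ⇑(multOp g u)) 2 volume) =
      (fun y : ℝ≥0∞ => y ^ (1 / 2 : ℝ)) ∘ fun i => ∫⁻ x, ‖(f i x - g x) * u x‖ₑ ^ 2 := by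
    ext i
    rw [eLpNorm_congr_ae (hae i), eLpNorm_eq_lintegral_rpow_enorm_toReal (by simp) (by simp)]
    simp
  rw [h4]
  simpa using h3

/-! ### Limits along translations by periods -/

theorem coe_multElt (a : C(EReal, ℂ)) : (multElt a : L2R →L[ℂ] L2R) = multOp (ofExtended a) :=
  rfl

theorem coe_inclusion {B : Type*} [Semiring B] [Algebra ℂ B] [StarRing B] [StarModule ℂ B]
    {S T : StarSubalgebra ℂ B} (h : S ≤ T) (A : S) : ((StarSubalgebra.inclusion h A : T) : B) = A :=
  rfl

/-- The automorphism `A ↦ T A T⁻¹` of `𝓛(L²(ℝ))`, for the translation `T u = u(· + t)`. -/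
def translationConj (t : ℝ) : (L2R →L[ℂ] L2R) →⋆ₐ[ℂ] (L2R →L[ℂ] L2R) where
  toFun A := translation t * A * translation (-t)
  map_one' := by
    ext1 u
    simp only [mul_apply_eq_comp, one_apply_eq_self]
    rw [translation_add, add_neg_cancel, translation_zero]
  map_mul' A B := by
    ext1 u
    simp only [mul_apply_eq_comp]
    rw [translation_add (-t) t, neg_add_cancel, translation_zero]
  map_zero' := by simp
  map_add' A B := by rw [mul_add, add_mul]
  commutes' c := by
    rw [(Algebra.commutes c (translation t)).symm, mul_assoc]
    ext1 u
    simp only [mul_apply_eq_comp]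
    rw [translation_add, add_neg_cancel, translation_zero]
  map_star' A := by
    rw [star_mul, star_mul, star_translation, star_translation, neg_neg, mul_assoc]

theorem translationConj_apply (t : ℝ) (A : L2R →L[ℂ] L2R) (u : L2R) :
    translationConj t A u = translation t (A (translation (-t) u)) := rfl

theorem translationConj_fourierMult (b : ℝ →ᵇ ℂ) (t : ℝ) :
    translationConj t (fourierMult b) = fourierMult b := by
  ext1 u
  rw [translationConj_apply, fourierMult_translation, translation_add, add_neg_cancel,
    translation_zero]

theorem translationConj_multOp (f : ℝ →ᵇ ℂ) (t : ℝ) :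
    translationConj t (multOp f) = multOp (f.compContinuous ⟨fun x => x + t, by fun_prop⟩) := by
  ext1 u
  apply Lp.ext
  have hq := (measurePreserving_add_right (volume : Measure ℝ) t).quasiMeasurePreserving
  filter_upwards [translation_coe t (multOp f (translation (-t) u)),
    multOp_coe (f.compContinuous ⟨fun x => x + t, by fun_prop⟩) u,
    hq.ae_eq_comp (multOp_coe f (translation (-t) u)),
    hq.ae_eq_comp (translation_coe (-t) u)] with x h1 h2 h3 h4
  simp only [Function.comp_apply] at h3 h4
  rw [translationConj_apply, h1, h3, h4, h2, add_neg_cancel_right]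
  rfl

/-- The conjugations by the translations by integer multiples of the period `2π`. -/
abbrev periodConj (n : ℤ) : (L2R →L[ℂ] L2R) →⋆ₐ[ℂ] (L2R →L[ℂ] L2R) :=
  translationConj (n * (2 * Real.pi))

theorem periodConj_expFun (n k : ℤ) : periodConj n (multOp (expFun k)) = multOp (expFun k) := by
  rw [translationConj_multOp]
  congr 1
  ext x
  exact (expFun_periodic k).int_mul n x

/-- The operators in `𝔄^◇` commute with the translations by the periods. -/
theorem mem_strongLimitGraph_diag (l : Filter ℤ) {A : L2R →L[ℂ] L2R} (hA : A ∈ algDiamond) :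
    (A, A) ∈ strongLimitGraph periodConj l := by
  set S : StarSubalgebra ℂ (L2R →L[ℂ] L2R) := (strongLimitGraph periodConj l).comap
    ((StarAlgHom.id ℂ _).prod (StarAlgHom.id ℂ _))
  have hS : IsClosed (S : Set (L2R →L[ℂ] L2R)) :=
    (isClosed_strongLimitGraph periodConj l).preimage (continuous_id.prodMk continuous_id)
  have key : ∀ B : L2R →L[ℂ] L2R, (∀ n, periodConj n B = B) → B ∈ S := by
    intro B hB
    refine mem_strongLimitGraph.2 ⟨fun u => ?_, fun u => ?_⟩
    · simpa [hB] using tendsto_const_nhds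
    · simpa [map_star, hB] using tendsto_const_nhds
  exact algDiamond_le_of_mem hS (fun k => key _ fun n => periodConj_expFun n k)
    (fun b => key _ fun n => translationConj_fourierMult _ _) hA

/-- The translates of `a(M)` by the periods tend strongly to `a(e) I`. -/
theorem mem_strongLimitGraph_mult {l : Filter ℤ} [l.IsCountablyGenerated] {e : EReal}
    (hl : ∀ x : ℝ, Tendsto (fun n : ℤ => ((x + n * (2 * Real.pi) : ℝ) : EReal)) l (𝓝 e))
    (a : C(EReal, ℂ)) : (multOp (ofExtended a), a e • 1) ∈ strongLimitGraph periodConj l := by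
  have key : ∀ a : C(EReal, ℂ), ∀ u, Tendsto (fun n => periodConj n (multOp (ofExtended a)) u) l
      (𝓝 ((a e • 1 : L2R →L[ℂ] L2R) u)) := by
    intro a u
    have h : (a e • 1 : L2R →L[ℂ] L2R) = multOp (BoundedContinuousFunction.const ℝ (a e)) := by
      rw [← Algebra.algebraMap_eq_smul_one, ← AlgHomClass.commutes multHom]
      rfl
    simp_rw [h, translationConj_multOp]
    refine tendsto_multOp (C := ‖ofExtended a‖) (fun n => ?_) (fun x => ?_) u
    · exact norm_compContinuous_le _ _
    · exact (a.continuous.tendsto e).comp (hl x)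
  refine mem_strongLimitGraph.2 ⟨key a, ?_⟩
  have h := key (star a)
  have h2 : multOp (ofExtended (star a)) = star (multOp (ofExtended a)) :=
    map_star multHom (ofExtended a)
  simp_rw [h2] at h
  simpa using h

theorem multOp_expFun_mem (k : ℤ) : multOp (expFun k) ∈ algDiamond :=
  StarSubalgebra.le_topologicalClosure _
    (StarAlgebra.subset_adjoin ℂ _ (Or.inl ⟨_, expFun_periodic k, rfl⟩))

theorem fourierMult_mem (b : C(EReal, ℂ)) : fourierMult (ofExtended b) ∈ algDiamond :=
  StarSubalgebra.le_topologicalClosure _ (StarAlgebra.subset_adjoin ℂ _ (Or.inr ⟨b, rfl⟩))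

/-- The pairs `(A, B)` with `B ∈ 𝔄^◇` the limit of `A` along the translations by periods. -/
def limitGraph (l : Filter ℤ) : StarSubalgebra ℂ ((L2R →L[ℂ] L2R) × algDiamond) :=
  (strongLimitGraph periodConj l).comap ((StarAlgHom.fst ℂ (L2R →L[ℂ] L2R) algDiamond).prod
    (algDiamond.subtype.comp (StarAlgHom.snd ℂ (L2R →L[ℂ] L2R) algDiamond)))

theorem mem_limitGraph {l : Filter ℤ} {A : L2R →L[ℂ] L2R} {B : algDiamond} :
    (A, B) ∈ limitGraph l ↔ (A, (B : L2R →L[ℂ] L2R)) ∈ strongLimitGraph periodConj l := Iff.rfl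

theorem isClosed_limitGraph (l : Filter ℤ) :
    IsClosed (limitGraph l : Set ((L2R →L[ℂ] L2R) × algDiamond)) :=
  (isClosed_strongLimitGraph periodConj l).preimage
    (continuous_fst.prodMk (continuous_subtype_val.comp continuous_snd))

theorem limitGraph_unique {l : Filter ℤ} [l.NeBot] {A : L2R →L[ℂ] L2R} {B B' : algDiamond}
    (h : (A, B) ∈ limitGraph l) (h' : (A, B') ∈ limitGraph l) : B = B' := by
  ext1
  ext1 u
  exact tendsto_nhds_unique ((mem_strongLimitGraph.1 (mem_limitGraph.1 h)).1 u)
    ((mem_strongLimitGraph.1 (mem_limitGraph.1 h')).1 u)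

theorem diag_mem_limitGraph (l : Filter ℤ) (A : algDiamond) :
    ((A : L2R →L[ℂ] L2R), A) ∈ limitGraph l :=
  mem_limitGraph.2 (mem_strongLimitGraph_diag l A.2)

section

variable {l : Filter ℤ} [l.IsCountablyGenerated] {e : EReal}

theorem mult_mem_limitGraph
    (hl : ∀ x : ℝ, Tendsto (fun n : ℤ => ((x + n * (2 * Real.pi) : ℝ) : EReal)) l (𝓝 e))
    (a : C(EReal, ℂ)) : (multOp (ofExtended a), a e • 1) ∈ limitGraph l :=
  mem_limitGraph.2 (mem_strongLimitGraph_mult hl a)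

/-- Every operator in `𝔄` has a limit, and it belongs to `𝔄^◇`. -/
theorem alg_le_map_limitGraph [l.NeBot]
    (hl : ∀ x : ℝ, Tendsto (fun n : ℤ => ((x + n * (2 * Real.pi) : ℝ) : EReal)) l (𝓝 e)) :
    alg ≤ (limitGraph l).map (StarAlgHom.fst ℂ (L2R →L[ℂ] L2R) algDiamond) := by
  refine alg_le_of_mem ?_ ?_ ?_ ?_
  · exact isClosed_map_fst_of_graph (isClosed_limitGraph l) limitGraph_unique
  · exact fun a => StarSubalgebra.mem_map.2 ⟨_, mult_mem_limitGraph hl a, rfl⟩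
  · exact fun k => StarSubalgebra.mem_map.2
      ⟨_, diag_mem_limitGraph l ⟨_, multOp_expFun_mem k⟩, rfl⟩
  · exact fun b => StarSubalgebra.mem_map.2
      ⟨_, diag_mem_limitGraph l ⟨_, fourierMult_mem b⟩, rfl⟩

theorem exists_hom_mem_limitGraph [l.NeBot]
    (hl : ∀ x : ℝ, Tendsto (fun n : ℤ => ((x + n * (2 * Real.pi) : ℝ) : EReal)) l (𝓝 e)) :
    ∃ ψ : alg →⋆ₐ[ℂ] algDiamond, ∀ a : alg, ((a : L2R →L[ℂ] L2R), ψ a) ∈ limitGraph l :=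
  exists_starAlgHom_of_graph limitGraph_unique (alg_le_map_limitGraph hl)

/-- Along the translations by periods that go to `e = ±∞`, the operators in `𝔄` have limits, and the
limit is a star homomorphism onto `𝔄^◇`. -/
theorem exists_limitHom [l.NeBot]
    (hl : ∀ x : ℝ, Tendsto (fun n : ℤ => ((x + n * (2 * Real.pi) : ℝ) : EReal)) l (𝓝 e)) :
    ∃ ψ : alg →⋆ₐ[ℂ] algDiamond,
      (∀ A : algDiamond, ψ (StarSubalgebra.inclusion algDiamond_le_alg A) = A) ∧
      ∀ a : C(EReal, ℂ), ψ (multElt a) = a e • 1 := by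
  obtain ⟨ρ, hρ⟩ := exists_hom_mem_limitGraph hl
  have hval : ∀ {A : alg} {T : L2R →L[ℂ] L2R} {B : algDiamond}, (A : L2R →L[ℂ] L2R) = T →
      (T, B) ∈ limitGraph l → ρ A = B := by
    rintro A T B rfl h
    exact limitGraph_unique (hρ A) h
  refine ⟨ρ, fun A => ?_, fun a => ?_⟩
  · refine hval ?_ (diag_mem_limitGraph l A)
    exact coe_inclusion algDiamond_le_alg A
  · refine hval ?_ (mult_mem_limitGraph hl a)
    exact coe_multElt a

end

theorem exists_limitHom_top : ∃ ψ : alg →⋆ₐ[ℂ] algDiamond,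
    (∀ A : algDiamond, ψ (StarSubalgebra.inclusion algDiamond_le_alg A) = A) ∧
      ∀ a : C(EReal, ℂ), ψ (multElt a) = a ⊤ • 1 :=
  exists_limitHom (l := atTop) fun x => EReal.tendsto_coe_atTop.comp <|
    tendsto_atTop_add_const_left _ x <|
      tendsto_intCast_atTop_atTop.atTop_mul_const Real.two_pi_pos

theorem exists_limitHom_bot : ∃ ψ : alg →⋆ₐ[ℂ] algDiamond,
    (∀ A : algDiamond, ψ (StarSubalgebra.inclusion algDiamond_le_alg A) = A) ∧
      ∀ a : C(EReal, ℂ), ψ (multElt a) = a ⊥ • 1 :=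
  exists_limitHom (l := atBot) fun x => EReal.tendsto_coe_atBot.comp <|
    tendsto_atBot_add_const_left _ x <|
      (tendsto_intCast_atBot_iff.2 tendsto_id).atBot_mul_const Real.two_pi_pos

/-! ### Compact operators -/

/-- A function on `ℝ` that vanishes at infinity extends by zero to a continuous function on
`[-∞, +∞]`. -/
theorem exists_ofExtended_eq (f : ℝ →ᵇ ℂ) (hf : Tendsto f (cocompact ℝ) (𝓝 0)) :
    ∃ a : C(EReal, ℂ), ofExtended a = f ∧ a ⊥ = 0 ∧ a ⊤ = 0 := by
  rw [cocompact_eq_atBot_atTop, tendsto_sup] at hf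
  set g : EReal → ℂ := fun y => EReal.rec (motive := fun _ => ℂ) 0 f 0 y with hg
  have hcont : Continuous g := by
    rw [continuous_iff_continuousAt]
    intro y
    induction y with
    | bot =>
      refine Metric.tendsto_nhds.2 fun ε hε => ?_
      obtain ⟨R, hR⟩ := eventually_atBot.1 (Metric.tendsto_nhds.1 hf.1 ε hε)
      filter_upwards [Iio_mem_nhds (EReal.bot_lt_coe R)] with y hy
      induction y with
      | bot => simpa [hg] using hε
      | coe x => exact hR x (EReal.coe_lt_coe_iff.1 hy).le
      | top => simp at hy
    | coe x =>
      exact (EReal.isOpenEmbedding_coe.continuousAt_iff (x := x)).1 f.continuous.continuousAt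
    | top =>
      refine Metric.tendsto_nhds.2 fun ε hε => ?_
      obtain ⟨R, hR⟩ := eventually_atTop.1 (Metric.tendsto_nhds.1 hf.2 ε hε)
      filter_upwards [Ioi_mem_nhds (EReal.coe_lt_top R)] with y hy
      induction y with
      | bot => simp at hy
      | coe x => exact hR x (EReal.coe_lt_coe_iff.1 hy).le
      | top => simpa [hg] using hε
  exact ⟨⟨g, hcont⟩, rfl, rfl, rfl⟩

/-- The function `x ↦ e^{iξx} h(x)` in `L²(ℝ)`. -/
def modulation (h : SchwartzMap ℝ ℂ) (ξ : ℝ) : L2R := multOp (character ξ) (h.toLp 2 volume)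

theorem modulation_coe (h : SchwartzMap ℝ ℂ) (ξ : ℝ) :
    modulation h ξ =ᵐ[volume] fun x => character ξ x * h x := by
  filter_upwards [multOp_coe (character ξ) (h.toLp 2 volume), h.coeFn_toLp 2 volume] with x h1 h2
  rw [modulation, h1, h2]

theorem modulation_zero (h : SchwartzMap ℝ ℂ) : modulation h 0 = h.toLp 2 volume := by
  apply Lp.ext
  filter_upwards [modulation_coe h 0, h.coeFn_toLp 2 volume] with x h1 h2
  rw [h1, h2, character_apply]
  simp

theorem continuous_modulation (h : SchwartzMap ℝ ℂ) : Continuous (modulation h) := by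
  rw [continuous_iff_continuousAt]
  intro ξ
  refine tendsto_multOp (C := 1) (fun η => ?_) (fun x => ?_) _
  · exact norm_ofNormedAddCommGroup_le _ zero_le_one _
  · have h : Continuous fun η => character η x := by
      simp only [character_apply]
      fun_prop
    exact h.tendsto ξ

/-- The adjoint of the multiplication by a Schwartz function, followed by the Fourier transform,
pairs with the modulations of that function. -/
theorem fourierL2_star_multOp (h u : SchwartzMap ℝ ℂ) :
    fourierL2 (star (multOp h.toBoundedContinuousFunction) (u.toLp 2 volume)) =ᵐ[volume]
      fun ξ => ((Real.sqrt (2 * Real.pi)⁻¹ : ℝ) : ℂ) *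
        inner ℂ (modulation h ξ) (u.toLp 2 volume) := by
  set v : SchwartzMap ℝ ℂ := SchwartzMap.smulLeftCLM ℂ
    (SchwartzMap.postcompCLM (𝕜 := ℝ) (Complex.conjCLE : ℂ →L[ℝ] ℂ) h) u
  have hv : ∀ x, v x = star (h x) * u x := by
    intro x
    rw [SchwartzMap.smulLeftCLM_apply_apply (SchwartzMap.hasTemperateGrowth _)]
    rfl
  have h1 : star (multOp h.toBoundedContinuousFunction) (u.toLp 2 volume) = v.toLp 2 volume := by
    rw [← multHom_apply, ← map_star, multHom_apply]
    apply Lp.ext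
    filter_upwards [multOp_coe (star h.toBoundedContinuousFunction) (u.toLp 2 volume),
      u.coeFn_toLp 2 volume, v.coeFn_toLp 2 volume] with x h1 h2 h3
    rw [h1, h2, h3, hv]
    rfl
  rw [h1]
  filter_upwards [fourierL2_schwartz v] with ξ h2
  rw [h2, L2.inner_def]
  congr 1
  apply integral_congr_ae
  filter_upwards [modulation_coe h ξ, u.coeFn_toLp 2 volume] with x h3 h4
  rw [h3, h4, hv, character_apply, RCLike.inner_apply, map_mul, ← Complex.exp_conj]
  simp only [map_mul, Complex.conj_ofReal, Complex.conj_I, Complex.ofReal_mul]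
  rw [show -(Complex.I * x * ξ) = (ξ : ℂ) * x * -Complex.I by ring]
  simp only [RCLike.star_def]
  ring

/-- The operator of rank one given by the functions `e^{iξx} h(x)` and `e^{iξx} h'(x)`. -/
def modulationRankOne (h h' : SchwartzMap ℝ ℂ) (ξ : ℝ) : L2R →L[ℂ] L2R :=
  InnerProductSpace.rankOne ℂ (modulation h ξ) (modulation h' ξ)

theorem continuous_modulationRankOne (h h' : SchwartzMap ℝ ℂ) :
    Continuous (modulationRankOne h h') :=
  (ContinuousLinearMap.smulRightL ℂ L2R L2R).continuous₂.comp
    (((innerSL ℂ).continuous.comp (continuous_modulation h')).prodMk (continuous_modulation h))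

/-- The matrix elements of `h(M) b(D) h'(M)*`, computed on the Fourier side. -/
theorem inner_multOp_fourierMult (h h' u w : SchwartzMap ℝ ℂ) (b : ℝ →ᵇ ℂ) :
    inner ℂ (w.toLp 2 volume : L2R) ((multOp h.toBoundedContinuousFunction * fourierMult b *
      star (multOp h'.toBoundedContinuousFunction)) (u.toLp 2 volume)) =
    (((2 * Real.pi)⁻¹ : ℝ) : ℂ) * ∫ ξ, b ξ * inner ℂ (w.toLp 2 volume : L2R)
      (modulationRankOne h h' ξ (u.toLp 2 volume)) := by
  rw [mul_assoc, mul_apply_eq_comp, ← ContinuousLinearMap.adjoint_inner_left,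
    ← ContinuousLinearMap.star_eq_adjoint, ← fourierL2.inner_map_map, mul_apply_eq_comp]
  have h1 : ∀ v, fourierL2 (fourierMult b v) = multOp b (fourierL2 v) := fun v =>
    fourierL2.apply_symm_apply _
  rw [h1, L2.inner_def, ← integral_const_mul]
  apply integral_congr_ae
  filter_upwards [multOp_coe b (fourierL2 (star (multOp h'.toBoundedContinuousFunction)
    (u.toLp 2 volume))), fourierL2_star_multOp h w, fourierL2_star_multOp h' u] with ξ h2 h3 h4
  rw [h2, h3, h4, RCLike.inner_apply, map_mul, inner_conj_symm, modulationRankOne,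
    InnerProductSpace.rankOne_apply, inner_smul_right, Complex.conj_ofReal]
  have h5 : (((2 * Real.pi)⁻¹ : ℝ) : ℂ) = (Real.sqrt (2 * Real.pi)⁻¹ : ℂ) *
      (Real.sqrt (2 * Real.pi)⁻¹ : ℂ) := by
    rw [← Complex.ofReal_mul, Real.mul_self_sqrt two_pi_inv_pos.le]
  rw [h5]
  ring

theorem opNorm_le_of_inner_schwartz {T : L2R →L[ℂ] L2R} {C : ℝ} (hC : 0 ≤ C)
    (h : ∀ u w : SchwartzMap ℝ ℂ, ‖(inner ℂ (w.toLp 2 volume : L2R) (T (u.toLp 2 volume)) : ℂ)‖ ≤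
      C * ‖w.toLp 2 volume‖ * ‖u.toLp 2 volume‖) : ‖T‖ ≤ C := by
  have h1 : ∀ u w : L2R, ‖(inner ℂ w (T u) : ℂ)‖ ≤ C * ‖w‖ * ‖u‖ := by
    intro u w
    refine schwartz_induction (p := fun u => ‖(inner ℂ w (T u) : ℂ)‖ ≤ C * ‖w‖ * ‖u‖)
      (isClosed_le (by fun_prop) (by fun_prop)) (fun u => ?_) u
    exact schwartz_induction (p := fun w => ‖(inner ℂ w (T (u.toLp 2 volume)) : ℂ)‖ ≤
      C * ‖w‖ * ‖u.toLp 2 volume‖)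
      (isClosed_le (by fun_prop) (by fun_prop)) (fun w => h u w) w
  refine ContinuousLinearMap.opNorm_le_bound _ hC fun u => ?_
  rcases (norm_nonneg (T u)).eq_or_lt with h0 | h0
  · rw [← h0]; positivity
  · have h2 := h1 u (T u)
    rw [inner_self_eq_norm_sq_to_K] at h2
    refine le_of_mul_le_mul_right ?_ h0
    have h3 : ‖((‖T u‖ : ℂ)) ^ 2‖ = ‖T u‖ * ‖T u‖ := by
      rw [norm_pow, Complex.norm_real, norm_norm, sq]
    calc ‖T u‖ * ‖T u‖ = ‖((‖T u‖ : ℂ)) ^ 2‖ := h3.symm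
      _ ≤ C * ‖T u‖ * ‖u‖ := h2
      _ = C * ‖u‖ * ‖T u‖ := by ring

/-- If `β` is a probability density, then the operator `h(M) β(D) h'(M)*` is the average
`(2π)⁻¹ ∫ β(ξ) R(ξ) dξ` of the operators `R(ξ)` of rank one given by the modulations, hence close to
`(2π)⁻¹ R(0)` if `R(ξ)` is close to `R(0)` on the support of `β`. -/
theorem norm_multOp_fourierMult_sub_le (h h' : SchwartzMap ℝ ℂ) {β : ℝ → ℝ} {b : ℝ →ᵇ ℂ}
    (hb : ∀ ξ, b ξ = β ξ) (hβs : HasCompactSupport β) (hβ0 : ∀ ξ, 0 ≤ β ξ) (hβ1 : ∫ ξ, β ξ = 1)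
    {ε : ℝ} (hε : 0 ≤ ε)
    (hβR : ∀ ξ, β ξ ≠ 0 → ‖modulationRankOne h h' ξ - modulationRankOne h h' 0‖ ≤ ε) :
    ‖multOp h.toBoundedContinuousFunction * fourierMult b *
      star (multOp h'.toBoundedContinuousFunction) -
        (((2 * Real.pi)⁻¹ : ℝ) : ℂ) • modulationRankOne h h' 0‖ ≤ (2 * Real.pi)⁻¹ * ε := by
  have hpi : 0 ≤ (2 * Real.pi)⁻¹ := two_pi_inv_pos.le
  have hbs : HasCompactSupport b := by
    have h1 : (b : ℝ → ℂ) = fun ξ => (β ξ : ℂ) := funext hb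
    rw [h1]
    exact hβs.comp_left (g := fun r : ℝ => (r : ℂ)) (by simp)
  have hβi : Integrable β := by
    refine Continuous.integrable_of_hasCompactSupport ?_ hβs
    have h1 : β = fun ξ => (b ξ).re := funext fun ξ => by rw [hb, Complex.ofReal_re]
    rw [h1]
    exact Complex.continuous_re.comp b.continuous
  refine opNorm_le_of_inner_schwartz (by positivity) fun u w => ?_
  set U : L2R := u.toLp 2 volume
  set V : L2R := w.toLp 2 volume
  have hint : ∀ S : ℝ → L2R →L[ℂ] L2R, Continuous S → Integrable fun ξ =>
      b ξ * inner ℂ V (S ξ U) := fun S hS => by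
    refine Continuous.integrable_of_hasCompactSupport ?_ hbs.mul_right
    exact b.continuous.mul (continuous_const.inner (hS.clm_apply continuous_const))
  have hone : ∫ ξ, b ξ = 1 := by
    simp_rw [hb]
    rw [integral_complex_ofReal, hβ1, Complex.ofReal_one]
  have heq : (inner ℂ V ((multOp h.toBoundedContinuousFunction * fourierMult b *
      star (multOp h'.toBoundedContinuousFunction) -
        (((2 * Real.pi)⁻¹ : ℝ) : ℂ) • modulationRankOne h h' 0) U) : ℂ) =
      (((2 * Real.pi)⁻¹ : ℝ) : ℂ) * ∫ ξ, b ξ *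
        inner ℂ V ((modulationRankOne h h' ξ - modulationRankOne h h' 0) U) := by
    have h2 : ∀ ξ, b ξ * inner ℂ V ((modulationRankOne h h' ξ - modulationRankOne h h' 0) U) =
        b ξ * inner ℂ V (modulationRankOne h h' ξ U) -
          b ξ * inner ℂ V (modulationRankOne h h' 0 U) := by
      intro ξ
      rw [_root_.sub_apply, inner_sub_right, mul_sub]
    simp_rw [h2]
    rw [integral_sub (hint _ (continuous_modulationRankOne h h'))
      (hint (fun _ => modulationRankOne h h' 0) continuous_const), integral_mul_const, hone,
      one_mul, _root_.sub_apply, inner_sub_right, inner_multOp_fourierMult,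
      _root_.smul_apply, inner_smul_right, mul_sub]
  have hbound : ∀ ξ, ‖b ξ * inner ℂ V
      ((modulationRankOne h h' ξ - modulationRankOne h h' 0) U)‖ ≤ β ξ * (ε * ‖V‖ * ‖U‖) := by
    intro ξ
    rw [norm_mul, hb, Complex.norm_real, Real.norm_of_nonneg (hβ0 ξ)]
    rcases eq_or_ne (β ξ) 0 with h0 | h0
    · rw [h0, zero_mul, zero_mul]
    · refine mul_le_mul_of_nonneg_left ((norm_inner_le_norm _ _).trans ?_) (hβ0 ξ)
      rw [mul_comm ε, mul_assoc]
      refine mul_le_mul_of_nonneg_left ((ContinuousLinearMap.le_opNorm _ _).trans ?_)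
        (norm_nonneg _)
      exact mul_le_mul_of_nonneg_right (hβR ξ h0) (norm_nonneg _)
  rw [heq, norm_mul, Complex.norm_real, Real.norm_of_nonneg hpi, mul_assoc, mul_assoc]
  refine mul_le_mul_of_nonneg_left ?_ hpi
  refine (norm_integral_le_of_norm_le (hβi.mul_const _) (Eventually.of_forall hbound)).trans ?_
  rw [integral_mul_const, hβ1, one_mul, mul_assoc]

/-- The operator of rank one given by two Schwartz functions `h` and `h'` is a limit of multiples of
`h(M) β(D) h'(M)*`, where `β` runs through bump functions with shrinking supports. -/
theorem rankOne_schwartz_mem (J : Submodule ℂ (L2R →L[ℂ] L2R))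
    (hJ : IsClosed (J : Set (L2R →L[ℂ] L2R)))
    (hmem : ∀ (h h' : SchwartzMap ℝ ℂ) (b : C(EReal, ℂ)),
      multOp h.toBoundedContinuousFunction * fourierMult (ofExtended b) *
        star (multOp h'.toBoundedContinuousFunction) ∈ J) (h h' : SchwartzMap ℝ ℂ) :
    InnerProductSpace.rankOne ℂ (h.toLp 2 volume : L2R) (h'.toLp 2 volume : L2R) ∈ J := by
  have hc0 : (((2 * Real.pi)⁻¹ : ℝ) : ℂ) ≠ 0 := by exact_mod_cast two_pi_inv_pos.ne'
  suffices hs : (((2 * Real.pi)⁻¹ : ℝ) : ℂ) • modulationRankOne h h' 0 ∈ J by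
    rwa [J.smul_mem_iff hc0, modulationRankOne, modulation_zero, modulation_zero] at hs
  rw [← SetLike.mem_coe, ← hJ.closure_eq, Metric.mem_closure_iff]
  intro ε hε
  obtain ⟨δ, hδ, hδR⟩ := Metric.continuous_iff.1 (continuous_modulationRankOne h h') 0 ε hε
  let β : ContDiffBump (0 : ℝ) := ⟨δ / 2, δ, by positivity, by linarith⟩
  have hβC : Continuous fun ξ => (β.normed volume ξ : ℂ) :=
    Complex.continuous_ofReal.comp β.continuous_normed
  have hβS : HasCompactSupport fun ξ => (β.normed volume ξ : ℂ) :=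
    β.hasCompactSupport_normed.comp_left (g := fun r : ℝ => (r : ℂ)) (by simp)
  obtain ⟨C, hC⟩ := hβS.exists_bound_of_continuous hβC
  obtain ⟨b, hb, -, -⟩ := exists_ofExtended_eq (ofNormedAddCommGroup _ hβC C hC)
    hβS.is_zero_at_infty
  refine ⟨_, hmem h h' b, ?_⟩
  rw [dist_comm, dist_eq_norm]
  refine lt_of_le_of_lt (norm_multOp_fourierMult_sub_le h h' (β := β.normed volume)
    (fun ξ => by rw [hb]; rfl) β.hasCompactSupport_normed β.nonneg_normed β.integral_normed hε.le
    fun ξ hξ => ?_) (mul_lt_of_lt_one_left hε (inv_lt_one_of_one_lt₀ (by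
      linarith [Real.pi_gt_three])))
  rw [← Function.mem_support, β.support_normed_eq] at hξ
  rw [← dist_eq_norm]
  exact (hδR ξ hξ).le

theorem isCompactOperator_mem (J : Submodule ℂ (L2R →L[ℂ] L2R))
    (hJ : IsClosed (J : Set (L2R →L[ℂ] L2R)))
    (hmem : ∀ (h h' : SchwartzMap ℝ ℂ) (b : C(EReal, ℂ)),
      multOp h.toBoundedContinuousFunction * fourierMult (ofExtended b) *
        star (multOp h'.toBoundedContinuousFunction) ∈ J) {K : L2R →L[ℂ] L2R}
    (hK : IsCompactOperator K) : K ∈ J := by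
  refine mem_of_isCompactOperator J hJ (fun x y => ?_) hK
  refine schwartz_induction (p := fun x => InnerProductSpace.rankOne ℂ x y ∈ J)
    (hJ.preimage (by fun_prop)) (fun h => ?_) x
  exact schwartz_induction
    (p := fun y => InnerProductSpace.rankOne ℂ (h.toLp 2 volume : L2R) y ∈ J)
    (hJ.preimage (by fun_prop)) (fun h' => rankOne_schwartz_mem J hJ hmem h h') y

/-! ### The homomorphisms `ψ`, `ι` and `γ` -/

/-- The pair of the limits at `-∞` and at `+∞`. -/
theorem exists_psi : ∃ ψ : alg →⋆ₐ[ℂ] (algDiamond × algDiamond),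
    (∀ A : algDiamond, ψ (StarSubalgebra.inclusion algDiamond_le_alg A) = (A, A)) ∧
      ∀ a : C(EReal, ℂ), ψ (multElt a) = (a ⊥ • 1, a ⊤ • 1) := by
  obtain ⟨ψ₁, h1, h1'⟩ := exists_limitHom_bot
  obtain ⟨ψ₂, h2, h2'⟩ := exists_limitHom_top
  exact ⟨ψ₁.prod ψ₂, fun A => Prod.ext (h1 A) (h2 A), fun a => Prod.ext (h1' a) (h2' a)⟩

theorem exists_separating : ∃ χ : C(EReal, ℂ), χ ⊥ = 1 ∧ χ ⊤ = 0 := by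
  obtain ⟨f, h0, h1, -⟩ := exists_continuous_zero_one_of_isClosed (X := EReal)
    (s := {⊤}) (t := {⊥}) isClosed_singleton isClosed_singleton (by simp)
  refine ⟨⟨fun x => (f x : ℂ), by fun_prop⟩, ?_, ?_⟩
  · have := h1 (Set.mem_singleton ⊥)
    simp [this]
  · have := h0 (Set.mem_singleton ⊤)
    simp [this]

/-- If `χ(-∞) = 1` and `χ(+∞) = 0`, then `χ(M)A + (1 - χ)(M)B` has the limits `A` and `B`. -/
theorem psi_surjective {ψ : alg →⋆ₐ[ℂ] (algDiamond × algDiamond)}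
    (h1 : ∀ A : algDiamond, ψ (StarSubalgebra.inclusion algDiamond_le_alg A) = (A, A))
    (h2 : ∀ a : C(EReal, ℂ), ψ (multElt a) = (a ⊥ • 1, a ⊤ • 1)) : Function.Surjective ψ := by
  obtain ⟨χ, hχ, hχ'⟩ := exists_separating
  rintro ⟨A, B⟩
  refine ⟨multElt χ * StarSubalgebra.inclusion algDiamond_le_alg A +
    multElt (1 - χ) * StarSubalgebra.inclusion algDiamond_le_alg B, ?_⟩
  rw [map_add, map_mul, map_mul, h1, h1, h2, h2]
  ext1 <;> simp [hχ, hχ']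

/-- The compact operators are limits of combinations of operators `h(M) b(D) h'(M)*`, which `ψ` maps
to zero because `h` vanishes at `±∞`. -/
theorem psi_compact {ψ : alg →⋆ₐ[ℂ] (algDiamond × algDiamond)}
    (h2 : ∀ a : C(EReal, ℂ), ψ (multElt a) = (a ⊥ • 1, a ⊤ • 1)) {K : L2R →L[ℂ] L2R}
    (hK : IsCompactOperator K) : ∃ hK : K ∈ alg, ψ ⟨K, hK⟩ = 0 := by
  -- The kernel of `ψ`, as a space of operators on `L²(ℝ)`.
  set J : Submodule ℂ (L2R →L[ℂ] L2R) :=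
    (LinearMap.ker (ψ : alg →ₗ[ℂ] algDiamond × algDiamond)).map
      (alg.subtype : alg →ₗ[ℂ] (L2R →L[ℂ] L2R)) with hJ
  have hmemJ : ∀ {A : alg}, ψ A = 0 → (A : L2R →L[ℂ] L2R) ∈ J := fun {A} hA => ⟨A, hA, rfl⟩
  have hcl : IsClosed (J : Set (L2R →L[ℂ] L2R)) :=
    isClosed_alg.isClosedEmbedding_subtypeVal.isClosedMap _
      (isClosed_eq (continuous_starAlgHom ψ) continuous_const)
  obtain ⟨A, hA, rfl⟩ : K ∈ J := by
    refine isCompactOperator_mem J hcl (fun h h' b => ?_) hK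
    obtain ⟨a, ha, ha0, ha1⟩ := exists_ofExtended_eq h.toBoundedContinuousFunction
      (h.toZeroAtInfty.zero_at_infty')
    obtain ⟨a', ha', -⟩ := exists_ofExtended_eq h'.toBoundedContinuousFunction
      (h'.toZeroAtInfty.zero_at_infty')
    rw [← ha, ← ha']
    refine hmemJ (A := multElt a * fourierElt b * star (multElt a')) ?_
    rw [map_mul, map_mul, h2, ha0, ha1]
    ext1 <;> simp
  exact ⟨A.2, hA⟩

/-- The map `ι` as a star homomorphism. -/
def iotaHom : SymbolAlg →⋆ₐ[ℂ] (L2R →L[ℂ] L2R) × (L2R →L[ℂ] L2R) where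
  toFun := iota
  map_one' := Prod.ext (map_one sideHom) (map_one sideHom)
  map_mul' f g := Prod.ext (map_mul sideHom (restrictSide (-1) f) (restrictSide (-1) g))
    (map_mul sideHom (restrictSide 1 f) (restrictSide 1 g))
  map_zero' := Prod.ext (map_zero sideHom) (map_zero sideHom)
  map_add' f g := Prod.ext (map_add sideHom (restrictSide (-1) f) (restrictSide (-1) g))
    (map_add sideHom (restrictSide 1 f) (restrictSide 1 g))
  commutes' c := Prod.ext (AlgHomClass.commutes sideHom c) (AlgHomClass.commutes sideHom c)
  map_star' f := Prod.ext (map_star sideHom (restrictSide (-1) f))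
    (map_star sideHom (restrictSide 1 f))

theorem iotaHom_apply (g : SymbolAlg) : iotaHom g = iota g := rfl

theorem iota_eq (g : SymbolAlg) :
    iota g = (sideHom (restrictSide (-1) g), sideHom (restrictSide 1 g)) := rfl

theorem iota_injective : Function.Injective iota := by
  intro f g h
  rw [iota_eq, iota_eq, Prod.mk.injEq] at h
  have h1 := sideHom_injective h.1
  have h2 := sideHom_injective h.2
  ext1 ⟨x, s⟩
  rcases Int.units_eq_one_or s with rfl | rfl
  · exact DFunLike.congr_fun h2 x
  · exact DFunLike.congr_fun h1 x

/-- The symbol with given restrictions to `S¹ × {-1}` and `S¹ × {+1}`. -/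
def glueSides (f g : CircleAlg) : SymbolAlg where
  toFun v := if v.2 = 1 then g v.1 else f v.1
  continuous_toFun := by
    rw [continuous_iff_continuousAt]
    rintro ⟨x, s⟩
    have hs : ∀ᶠ v : CoSphere in 𝓝 (x, s), v.2 = s :=
      continuous_snd.continuousAt.eventually ((isOpen_discrete {s}).mem_nhds (Set.mem_singleton s))
    rcases Int.units_eq_one_or s with rfl | rfl
    · refine ((g.continuous.comp continuous_fst).continuousAt).congr ?_
      filter_upwards [hs] with v hv
      simp [hv]
    · refine ((f.continuous.comp continuous_fst).continuousAt).congr ?_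
      filter_upwards [hs] with v hv
      simp [hv]

theorem restrictSide_glueSides (f g : CircleAlg) :
    restrictSide (-1) (glueSides f g) = f ∧ restrictSide 1 (glueSides f g) = g :=
  ⟨rfl, rfl⟩

/-- Every operator in `𝔄^◇` is represented by a symbol on the circle. -/
theorem algDiamond_le_range : algDiamond ≤ sideHom.range := by
  have h : IsClosed (Set.range sideHom) :=
    isClosed_range_of_injective (X := CircleAlg) (Y := L2R →L[ℂ] L2R) sideHom sideHom_injective
  exact algDiamond_le_of_mem h (fun k => ⟨_, sideHom_const_Y k⟩)
    (fun b => ⟨_, sideHom_fourierSymbol b⟩)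

/-- The inclusion of `𝔄^◇ ⊕ 𝔄^◇` into `𝓛(L²(ℝ)) ⊕ 𝓛(L²(ℝ))`. -/
def diamondIncl : algDiamond × algDiamond →⋆ₐ[ℂ] (L2R →L[ℂ] L2R) × (L2R →L[ℂ] L2R) :=
  (algDiamond.subtype.comp (StarAlgHom.fst ℂ algDiamond algDiamond)).prod
    (algDiamond.subtype.comp (StarAlgHom.snd ℂ algDiamond algDiamond))

theorem diamondIncl_apply (P : algDiamond × algDiamond) :
    diamondIncl P = ((P.1 : L2R →L[ℂ] L2R), (P.2 : L2R →L[ℂ] L2R)) := rfl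

theorem diamondIncl_injective : Function.Injective diamondIncl := by
  rintro ⟨A, B⟩ ⟨A', B'⟩ h
  rw [diamondIncl_apply, diamondIncl_apply, Prod.mk.injEq] at h
  exact Prod.ext (Subtype.ext h.1) (Subtype.ext h.2)

/-- The map `γ = ι⁻¹ ∘ ψ`. -/
theorem exists_gamma (ψ : alg →⋆ₐ[ℂ] (algDiamond × algDiamond)) :
    ∃ γ : alg →⋆ₐ[ℂ] SymbolAlg, ∀ A, iota (γ A) = diamondIncl (ψ A) := by
  refine exists_starAlgHom_lift iotaHom iota_injective (diamondIncl.comp ψ) fun A => ?_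
  obtain ⟨f, hf⟩ := algDiamond_le_range (ψ A).1.2
  obtain ⟨g, hg⟩ := algDiamond_le_range (ψ A).2.2
  refine ⟨glueSides f g, ?_⟩
  rw [iotaHom_apply, iota_eq, (restrictSide_glueSides f g).1, (restrictSide_glueSides f g).2]
  exact Prod.ext hf hg

theorem expElt_eq (k : ℤ) : expElt k =
    StarSubalgebra.inclusion algDiamond_le_alg ⟨multOp (expFun k), multOp_expFun_mem k⟩ := rfl

theorem fourierElt_eq (b : C(EReal, ℂ)) : fourierElt b =
    StarSubalgebra.inclusion algDiamond_le_alg ⟨_, fourierMult_mem b⟩ := rfl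

/-- The values of `γ` on the generators are the symbols that represent them. -/
theorem isBoundarySymbol_of_iota {ψ : alg →⋆ₐ[ℂ] (algDiamond × algDiamond)}
    (h1 : ∀ A : algDiamond, ψ (StarSubalgebra.inclusion algDiamond_le_alg A) = (A, A))
    (h2 : ∀ a : C(EReal, ℂ), ψ (multElt a) = (a ⊥ • 1, a ⊤ • 1)) {γ : alg →⋆ₐ[ℂ] SymbolAlg}
    (hγ : ∀ A, iota (γ A) = diamondIncl (ψ A)) : IsBoundarySymbol γ := by
  have key : ∀ {A : alg} {f g : CircleAlg}, sideHom f = (ψ A).1 →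
      sideHom g = (ψ A).2 → γ A = glueSides f g := by
    intro A f g hf hg
    apply iota_injective
    rw [hγ, iota_eq, (restrictSide_glueSides f g).1, (restrictSide_glueSides f g).2, hf, hg]
    rfl
  have hmult : ∀ a, γ (multElt a) = glueSides (a ⊥ • 1) (a ⊤ • 1) := fun a =>
    key (by rw [h2, map_smul, map_one]; rfl) (by rw [h2, map_smul, map_one]; rfl)
  have hexp : ∀ k, γ (expElt k) =
      glueSides (ContinuousMap.const S1 (Y (-k))) (ContinuousMap.const S1 (Y (-k))) := fun k =>
    key (by rw [expElt_eq, h1, sideHom_const_Y]) (by rw [expElt_eq, h1, sideHom_const_Y])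
  have hfourier : ∀ b, γ (fourierElt b) = glueSides (fourierSymbol b) (fourierSymbol b) := fun b =>
    key (by rw [fourierElt_eq, h1, sideHom_fourierSymbol])
      (by rw [fourierElt_eq, h1, sideHom_fourierSymbol])
  refine ⟨fun a x => ?_, fun a x => ?_, fun k v => ?_, fun b φ s => ?_⟩
  · rw [hmult]; rfl
  · rw [hmult]; rfl
  · rw [hexp]; exact ite_self _
  · rw [hfourier]; exact ite_self _

theorem isBoundarySymbol_unique {γ γ' : alg →⋆ₐ[ℂ] SymbolAlg} (h : IsBoundarySymbol γ)
    (h' : IsBoundarySymbol γ') : γ' = γ := by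
  refine alg_hom_ext (Y := SymbolAlg) (fun a => ?_) (fun k => ?_) (fun b => ?_)
  · ext1 ⟨x, s⟩
    rcases Int.units_eq_one_or s with rfl | rfl
    · rw [h.mult_pos, h'.mult_pos]
    · rw [h.mult_neg, h'.mult_neg]
  · ext1 v
    rw [h.exp, h'.exp]
  · ext1 ⟨x, s⟩
    obtain ⟨φ, rfl⟩ := QuotientAddGroup.mk_surjective x
    exact (h'.fourier b φ s).trans (h.fourier b φ s).symm

set_option synthInstance.maxHeartbeats 100000 in
/-- As `ψ` is surjective and `ι ∘ γ = ψ`, the restriction of `ι` to the image of `γ` is an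
isomorphism onto `𝔄^◇ ⊕ 𝔄^◇`. -/
theorem exists_rangeEquiv {ψ : alg →⋆ₐ[ℂ] (algDiamond × algDiamond)}
    (hψ : Function.Surjective ψ) {γ : alg →⋆ₐ[ℂ] SymbolAlg}
    (hγ : ∀ A, iota (γ A) = diamondIncl (ψ A)) :
    ∃ e : γ.range ≃⋆ₐ[ℂ] (algDiamond × algDiamond), ∀ g : γ.range, iota g = diamondIncl (e g) := by
  obtain ⟨ρ, hρ⟩ := exists_starAlgHom_lift diamondIncl diamondIncl_injective
    (iotaHom.comp γ.range.subtype) fun ⟨_, A, hA⟩ => ⟨ψ A, by rw [← hγ]; exact congrArg iota hA⟩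
  have hρ' : ∀ g : γ.range, diamondIncl (ρ g) = iota g := hρ
  have hbij : Function.Bijective ρ := by
    constructor
    · intro f g h
      apply Subtype.ext
      apply iota_injective
      rw [← hρ', ← hρ', h]
    · intro P
      obtain ⟨A, rfl⟩ := hψ P
      refine ⟨⟨γ A, A, rfl⟩, diamondIncl_injective ?_⟩
      rw [hρ', hγ]
  exact ⟨StarAlgEquiv.ofBijective ρ hbij, fun g => (hρ' g).symm⟩

end PeriodicPsiDO
end

theorem mainTheorem3 :
    ∃ γ : alg →⋆ₐ[ℂ] SymbolAlg,
      IsBoundarySymbol γ ∧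
      (∀ γ' : alg →⋆ₐ[ℂ] SymbolAlg, IsBoundarySymbol γ' → γ' = γ) ∧
      ∃ ψ : alg →⋆ₐ[ℂ] (algDiamond × algDiamond),
        Function.Surjective ψ ∧
        (∀ A : algDiamond, ψ (StarSubalgebra.inclusion algDiamond_le_alg A) = (A, A)) ∧
        (∀ a : C(EReal, ℂ), ψ (multElt a) = (a ⊥ • 1, a ⊤ • 1)) ∧
        (∀ K : L2R →L[ℂ] L2R, IsCompactOperator K → ∃ hK : K ∈ alg, ψ ⟨K, hK⟩ = 0) ∧
        (∀ A : alg, iota (γ A) = (((ψ A).1 : L2R →L[ℂ] L2R), ((ψ A).2 : L2R →L[ℂ] L2R))) ∧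
        ∃ e : γ.range ≃⋆ₐ[ℂ] (algDiamond × algDiamond),
          ∀ g : γ.range,
            iota g = (((e g).1 : L2R →L[ℂ] L2R), ((e g).2 : L2R →L[ℂ] L2R)) := by
  obtain ⟨ψ, h1, h2⟩ := exists_psi
  obtain ⟨γ, hγ⟩ := exists_gamma ψ
  have hψ := psi_surjective h1 h2
  have hγb := isBoundarySymbol_of_iota h1 h2 hγ
  exact ⟨γ, hγb, fun γ' h' => isBoundarySymbol_unique hγb h', ψ, hψ, h1, h2,
    fun K hK => psi_compact h2 hK, hγ, exists_rangeEquiv hψ hγ⟩
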